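/- Let $k\ge 1$, let $\mathcal G$ be a connected undirected simple graph on the agents $\mathcal I=\{1,\dots,n\}$ with edge weights $w_{ij}=w_{ji}>0$, and let $a_{ij}=w_{ij}$ if $i$ and $j$ are adjacent and $a_{ij}=0$ otherwise. Let $\mathcal I_c\subseteq\mathcal I$ and let $f_i:\mathbb R^k\to\mathbb R^k$, $i\in\mathcal I$, be such that * for $i\in\mathcal I_c$, $f_i(y)=(f_{i,1}(y_1),\dots,f_{i,k}(y_k))$, where every $f_{i,j}:\mathbb R\to\mathbb R$ is locally Lipschitz continuous with $f_{i,j}(0)=0$ and $f_{i,j}(s)\,s>0$ for all $s\ne 0$; * for $i\in\mathcal I\setminus\mathcal I_c$, $f_i$ is the component-wise signum, $f_i(y)=(\operatorname{sign}(y_1),\dots,\operatorname{sign}(y_k))$, where $\operatorname{sign}(0)=0$. Consider the closed-loop system $\dot x=h(x)$ on $\mathbb R^{kn}$, $x=(x_1,\dots,x_n)$, $x_i\in\mathbb R^k$, given by $$\dot x_i=f_i\Big(\sum_{j=1}^n a_{ij}(x_j-x_i)\Big),\qquad i\in\mathcal I .$$ A Filippov solution on $[0,T)$, $0<T\le\infty$,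 is a function $x:[0,T)\to\mathbb R^{kn}$ that is absolutely continuous on compact subintervals and satisfies, for almost every $t\in[0,T)$, $$\dot x(t)\in\mathcal F[h](x(t)),\qquad \mathcal F[h](x)=\bigcap_{\delta>0}\ \bigcap_{\mu(S)=0}\overline{\mathrm{co}}\,\big\{h(B(x,\delta)\setminus S)\big\},$$ where $\mu$ is the Lebesgue measure and $B(x,\delta)$ the open Euclidean ball. It is maximal if it is not the restriction of a Filippov solution on a larger interval $[0,T')$. We say that all Filippov solutions converge to consensus in finite time if every maximal Filippov solution $x$ is defined on $[0,\infty)$ and there exist $t^*>0$ and $\bar x\in\mathbb R^k$ with $x_i(t)=\bar x$ for all $i\in\mathcal I$ and all $t\ge t^*$. Then: 1. If $|\mathcal I|>2$, then all Filippov solutions converge to consensus in finite time if and only if $|\mathcal I_c|=1$. 2. If $|\mathcal I|=2$, then all Filippov solutions converge to consensus in finite time if and only if $|\mathcal I_c|\le 1$. -/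

import Mathlib

open MeasureTheory

noncomputable section

/-! ### Filippov solutions of an autonomous differential equation -/

section Filippov

variable {E : Type*} [NormedAddCommGroup E] [NormedSpace ℝ E] [MeasureSpace E]

/-- The Filippov set-valued map
`F[f](x) = ⋂_{δ > 0} ⋂_{μ(S) = 0} closure (co (f (B(x, δ) \ S)))`. -/
def filippovMap (f : E → E) (x : E) : Set E :=
  ⋂ (δ : ℝ) (_ : 0 < δ) (S : Set E) (_ : volume S = 0),
    closure (convexHull ℝ (f '' (Metric.ball x δ \ S)))

/-- `x` is a Filippov solution of `x' = f(x)` on `[0, T)`, where `0 < T ≤ ∞`: it is absolutely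
continuous on every compact interval `[0, s]` with `s < T`, and `x'(t) ∈ F[f](x(t))` for almost
every `t ∈ [0, T)`. The values of `x` outside `[0, T)` are irrelevant. -/
structure IsFilippovSolution (f : E → E) (T : EReal) (x : ℝ → E) : Prop where
  pos : 0 < T
  absCont : ∀ s : ℝ, 0 ≤ s → (s : EReal) < T → AbsolutelyContinuousOnInterval x 0 s
  inclusion : ∀ᵐ t : ℝ, 0 < t → (t : EReal) < T →
    ∃ v ∈ filippovMap f (x t), HasDerivAt x v t

/-- A Filippov solution on `[0, T)` is maximal if it is not the truncation of a Filippov solution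
with a larger interval of definition. In particular, every solution on `[0, ∞)` is maximal. -/
structure IsMaximalFilippovSolution (f : E → E) (T : EReal) (x : ℝ → E) : Prop where
  isSolution : IsFilippovSolution f T x
  not_extendable : ∀ (T' : EReal) (y : ℝ → E), T < T' → IsFilippovSolution f T' y →
    ¬ ∀ t : ℝ, 0 ≤ t → (t : EReal) < T → y t = x t

end Filippov

/-! ### The multi-agent system -/

/-- The state space `ℝ^{kn}` of `n` agents with states in `ℝ^k`, with its Euclidean norm;
`x (i, ℓ)` is the `ℓ`-th component of the state of agent `i`. -/
abbrev AgentState (n k : ℕ) : Type := EuclideanSpace ℝ (Fin n × Fin k)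

/-- The consensus state `𝟙 ⊗ c`, in which every agent is in the state `c`. -/
def consensusState (n : ℕ) {k : ℕ} (c : Fin k → ℝ) : AgentState n k :=
  WithLp.toLp 2 fun p => c p.2

open Classical in
/-- The entries `a_{ij}` of the weighted adjacency matrix of the graph `G` with weights `w`. -/
def weightedAdj {n : ℕ} (G : SimpleGraph (Fin n)) (w : Fin n → Fin n → ℝ) :
    Matrix (Fin n) (Fin n) ℝ :=
  Matrix.of fun i j => if G.Adj i j then w i j else 0

/-- The argument `∑_j a_{ij} (x_j - x_i) ∈ ℝ^k` of the control law of agent `i`. -/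
def relativeState {n k : ℕ} (A : Matrix (Fin n) (Fin n) ℝ) (x : AgentState n k) (i : Fin n) :
    Fin k → ℝ :=
  fun l => ∑ j, A i j * (x (j, l) - x (i, l))

/-- The closed-loop vector field `h`, whose block of agent `i` is
`f_i (∑_j a_{ij} (x_j - x_i))`. -/
def closedLoop {n k : ℕ} (A : Matrix (Fin n) (Fin n) ℝ)
    (f : Fin n → (Fin k → ℝ) → (Fin k → ℝ)) (x : AgentState n k) : AgentState n k :=
  WithLp.toLp 2 fun p => f p.1 (relativeState A x p.1) p.2

/-- The component-wise signum `sign_c`, with `sign 0 = 0`. -/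
def signC {k : ℕ} (w : Fin k → ℝ) : Fin k → ℝ := fun l => Real.sign (w l)

/-- The standing assumption on the control laws: the agents in `Ic` use component-wise,
sign-preserving, locally Lipschitz functions, and all other agents use the component-wise
signum. -/
structure ComponentwiseControl {n k : ℕ} (Ic : Finset (Fin n))
    (f : Fin n → (Fin k → ℝ) → (Fin k → ℝ)) : Prop where
  continuous_agents : ∀ i ∈ Ic, ∃ φ : Fin k → ℝ → ℝ,
    (∀ y l, f i y l = φ l (y l)) ∧
    ∀ l, LocallyLipschitz (φ l) ∧ φ l 0 = 0 ∧ ∀ s : ℝ, s ≠ 0 → 0 < φ l s * s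
  signum_agents : ∀ i, i ∉ Ic → f i = signC

/-- All Filippov solutions of `x' = h(x)` converge to (static) consensus in finite time: every
maximal Filippov solution exists for all times `t ≥ 0`, and there are a time `t₀ > 0` and a vector
`c ∈ ℝ^k` such that `x(t) = 𝟙 ⊗ c` for all `t ≥ t₀`. -/
def FiniteTimeConsensus {n k : ℕ} (h : AgentState n k → AgentState n k) : Prop :=
  ∀ (T : EReal) (x : ℝ → AgentState n k), IsMaximalFilippovSolution h T x →
    T = ⊤ ∧ ∃ t₀ : ℝ, 0 < t₀ ∧ ∃ c : Fin k → ℝ, ∀ t : ℝ, t₀ ≤ t → x t = consensusState n c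

end

open MeasureTheory

noncomputable section

open Filter Topology Set
open scoped NNReal RealInnerProductSpace

/-! ### Absolutely continuous functions and a.e. derivatives -/

section AbsolutelyContinuous

/-! Write U = -(L ⊗ I) (`relativeMap`) and let V(x) = -⟪Ux, x⟫/2 be the disagreement energy, whose
gradient is -Ux. For v in the Filippov map at x, a signum coordinate contributes (Ux)ₚ vₚ = |(Ux)ₚ|,
while a continuous coordinate has vₚ = ψₚ((Ux)ₚ) and contributes something nonnegative. Hence V
decreases at least at the rate Σ |(Ux)ₚ| over the signum coordinates (`fderiv_disagreement_le`).
Bounded energy bounds the velocities, so solutions are Lipschitz; local existence by Euler's method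
then extends them, and maximal solutions are global.

At most one continuous agent: in each component the entries of Ux sum to zero over the agents, so
the signum entries control all of Ux, and ‖Ux‖ ≥ c √V. Thus V' ≤ -c √V and V vanishes after finite
time. This gives consensus, but perhaps a drifting one. A single continuous agent pins the value,
since its velocity at consensus is ψ(0) = 0. For two signum agents the two velocities are opposite,
so the sum of the states is conserved.

No continuous agent, n > 2: arbitrarily close to any consensus state there are states where one
chosen agent has sign -1 and all the others +1. Averaging over the chosen agent puts the velocity
(n-2)/n · 𝟙 in the Filippov map, so a consensus state may drift forever
(`consensusState_mem_filippovMap`).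

Two or more continuous agents: keep the signum agents on the sliding surface (Ux)ₚ = 0, where every
velocity in [-1, 1] is available to them (`mem_filippovMap_of_sliding`). The required velocities
solve a Dirichlet problem with boundary the continuous agents, and are small near consensus. Along
such a solution only Lipschitz feedback dissipates energy, so V' ≥ -cV and V never reaches zero;
having two boundary agents allows V > 0 initially. -/

theorem AbsolutelyContinuousOnInterval.sub_le_mul_of_ae_hasDerivAt_le {g : ℝ → ℝ} {a b c : ℝ}
    (hab : a ≤ b) (hg : AbsolutelyContinuousOnInterval g a b)
    (h : ∀ᵐ t : ℝ, a < t → t < b → ∃ v ≤ c, HasDerivAt g v t) :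
    g b - g a ≤ c * (b - a) := by
  rw [← hg.integral_deriv_eq_sub]
  have hc : ∫ _ in a..b, c = c * (b - a) := by simp [mul_comm]
  rw [← hc]
  refine intervalIntegral.integral_mono_ae_restrict hab hg.intervalIntegrable_deriv
    intervalIntegrable_const ?_
  have hb : ∀ᵐ t : ℝ, t ≠ b := by simp [ae_iff, measure_singleton]
  have ha : ∀ᵐ t : ℝ, t ≠ a := by simp [ae_iff, measure_singleton]
  rw [EventuallyLE, ae_restrict_iff' measurableSet_Icc]
  filter_upwards [h, ha, hb] with t ht hta htb hmem
  obtain ⟨v, hv, hd⟩ := ht (lt_of_le_of_ne hmem.1 hta.symm) (lt_of_le_of_ne hmem.2 htb)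
  simpa [hd.deriv] using hv

theorem LipschitzOnWith.comp_absolutelyContinuousOnInterval {X Y : Type*} [PseudoMetricSpace X]
    [PseudoMetricSpace Y] {g : X → Y} {f : ℝ → X} {K : ℝ≥0} {s : Set X} {a b : ℝ}
    (hg : LipschitzOnWith K g s) (hf : AbsolutelyContinuousOnInterval f a b)
    (hs : MapsTo f (uIcc a b) s) : AbsolutelyContinuousOnInterval (g ∘ f) a b := by
  rw [absolutelyContinuousOnInterval_iff] at hf ⊢
  intro ε hε
  obtain ⟨δ, hδ, h⟩ := hf (ε / (K + 1)) (by positivity)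
  refine ⟨δ, hδ, fun E hE hlt => ?_⟩
  have h1 := h E hE hlt
  have hle : ∑ i ∈ Finset.range E.1, dist ((g ∘ f) (E.2 i).1) ((g ∘ f) (E.2 i).2) ≤
      K * ∑ i ∈ Finset.range E.1, dist (f (E.2 i).1) (f (E.2 i).2) := by
    rw [Finset.mul_sum]
    refine Finset.sum_le_sum fun i hi => ?_
    have := hE.1 i hi
    exact hg.dist_le_mul _ (hs this.1) _ (hs this.2)
  have hnn : 0 ≤ ∑ i ∈ Finset.range E.1, dist (f (E.2 i).1) (f (E.2 i).2) :=
    Finset.sum_nonneg fun _ _ => dist_nonneg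
  rw [lt_div_iff₀ (by positivity)] at h1
  nlinarith

theorem ContDiff.comp_absolutelyContinuousOnInterval {E F : Type*} [NormedAddCommGroup E]
    [NormedSpace ℝ E] [FiniteDimensional ℝ E] [NormedAddCommGroup F] [NormedSpace ℝ F]
    {g : E → F} {f : ℝ → E} {a b : ℝ}
    (hg : ContDiff ℝ 1 g) (hf : AbsolutelyContinuousOnInterval f a b) :
    AbsolutelyContinuousOnInterval (g ∘ f) a b := by
  obtain ⟨C, hC⟩ := hf.exists_bound
  have : ProperSpace E := FiniteDimensional.proper ℝ E
  obtain ⟨K, hK⟩ := (hg.contDiffOn (s := Metric.closedBall (0 : E) C)).exists_lipschitzOnWith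
    (by simp) (convex_closedBall _ _) (isCompact_closedBall _ _)
  exact hK.comp_absolutelyContinuousOnInterval hf fun t ht => by simpa using hC t ht

end AbsolutelyContinuous

/-! ### Existence of solutions by Euler's method -/

section Euler

variable {E : Type*} [NormedAddCommGroup E] [NormedSpace ℝ E]

/-- The Euler iterates with step size `η` for the vector field `g`. -/
def eulerIterate (g : E → E) (x₀ : E) (η : ℝ) : ℕ → E
  | 0 => x₀
  | m + 1 => eulerIterate g x₀ η m + η • g (eulerIterate g x₀ η m)

theorem eulerIterate_sub (g : E → E) (x₀ : E) (η : ℝ) {p q : ℕ} (hpq : p ≤ q) :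
    eulerIterate g x₀ η q - eulerIterate g x₀ η p =
      η • ∑ m ∈ Finset.Ico p q, g (eulerIterate g x₀ η m) := by
  induction q, hpq using Nat.le_induction with
  | base => simp
  | succ q hq ih =>
    rw [Finset.sum_Ico_succ_top hq, smul_add, ← ih, eulerIterate]
    abel

theorem norm_eulerIterate_sub_le {g : E → E} {M : ℝ} (hM : ∀ x, ‖g x‖ ≤ M) (x₀ : E) {η : ℝ}
    (hη : 0 ≤ η) {p q : ℕ} (hpq : p ≤ q) :
    ‖eulerIterate g x₀ η q - eulerIterate g x₀ η p‖ ≤ M * (η * (q - p)) := by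
  rw [eulerIterate_sub g x₀ η hpq, norm_smul, Real.norm_of_nonneg hη]
  have h : ‖∑ m ∈ Finset.Ico p q, g (eulerIterate g x₀ η m)‖ ≤
      ∑ m ∈ Finset.Ico p q, M := norm_sum_le_of_le _ fun m _ => hM _
  rw [Finset.sum_const, Nat.card_Ico, nsmul_eq_mul, Nat.cast_sub hpq] at h
  nlinarith

/-- A bounded map `g`, continuous or not, admits a Lipschitz curve through every point whose
difference quotients lie in the closed convex hull of the nearby values of `g`. -/
theorem exists_lipschitzWith_slope_mem [FiniteDimensional ℝ E] {g : E → E} {M : ℝ≥0}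
    (hM : ∀ x, ‖g x‖ ≤ M) (x₀ : E) :
    ∃ x : ℝ → E, x 0 = x₀ ∧ LipschitzWith M x ∧
      ∀ a b δ : ℝ, 0 ≤ a → a < b → M * (b - a) < δ → ∀ C : Set E, IsClosed C → Convex ℝ C →
        (∀ y ∈ Metric.ball (x a) δ, g y ∈ C) → (b - a)⁻¹ • (x b - x a) ∈ C := by
  have : ProperSpace E := FiniteDimensional.proper ℝ E
  have hη : ∀ N : ℕ, 0 < ((N : ℝ) + 1)⁻¹ := fun N => by positivity
  -- Piecewise constant interpolation of the Euler iterates with step 1/(N+1). The natural floor is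
  -- 0 at negative times, so the curve rests at `x₀` there.
  set X : ℕ → ℝ → E := fun N t =>
    eulerIterate g x₀ ((N : ℝ) + 1)⁻¹ ⌊((N : ℝ) + 1) * t⌋₊ with hX
  have hfl : ∀ N : ℕ, ∀ a b : ℝ, a ≤ b →
      ⌊((N : ℝ) + 1) * a⌋₊ ≤ ⌊((N : ℝ) + 1) * b⌋₊ := fun N a b hab =>
    Nat.floor_mono (by gcongr)
  have hlen : ∀ N : ℕ, ∀ a b : ℝ, a ≤ b →
      ((N : ℝ) + 1)⁻¹ * ((⌊((N : ℝ) + 1) * b⌋₊ : ℝ) - ⌊((N : ℝ) + 1) * a⌋₊) ≤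
        b - a + ((N : ℝ) + 1)⁻¹ := by
    intro N a b hab
    have hN : (0 : ℝ) < N + 1 := by positivity
    have h2 : ((N : ℝ) + 1) * a < ⌊((N : ℝ) + 1) * a⌋₊ + 1 := Nat.lt_floor_add_one _
    rw [inv_mul_le_iff₀ hN]
    have h3 : ((N : ℝ) + 1) * (b - a + ((N : ℝ) + 1)⁻¹) =
        ((N : ℝ) + 1) * b - ((N : ℝ) + 1) * a + 1 := by field_simp
    rw [h3]
    rcases le_or_gt 0 b with hb | hb
    · have h1 : (⌊((N : ℝ) + 1) * b⌋₊ : ℝ) ≤ ((N : ℝ) + 1) * b := Nat.floor_le (by positivity)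
      linarith
    · have h1 : ⌊((N : ℝ) + 1) * b⌋₊ = 0 := Nat.floor_of_nonpos (by nlinarith)
      have h0 : (0 : ℝ) ≤ ⌊((N : ℝ) + 1) * a⌋₊ := Nat.cast_nonneg _
      rw [h1]; push_cast; nlinarith
  have hbd : ∀ N : ℕ, ∀ a b : ℝ, a ≤ b →
      ‖X N b - X N a‖ ≤ M * (b - a + ((N : ℝ) + 1)⁻¹) := fun N a b hab =>
    (norm_eulerIterate_sub_le hM x₀ (hη N).le (hfl N a b hab)).trans
      (mul_le_mul_of_nonneg_left (hlen N a b hab) M.2)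
  have hX0 : ∀ N, X N 0 = x₀ := fun N => by simp [hX, eulerIterate]
  -- Pointwise limits along a nonprincipal ultrafilter take the place of an Arzelà–Ascoli
  -- subsequence.
  have hlim : ∀ t, ∃ y, Tendsto (fun N => X N t) (hyperfilter ℕ) (𝓝 y) := by
    intro t
    have hmem : ∀ N, X N t ∈ Metric.closedBall x₀ (M * (|t| + 1)) := by
      intro N
      have h1 : ((N : ℝ) + 1)⁻¹ ≤ 1 := inv_le_one_of_one_le₀ (by simp)
      rw [mem_closedBall_iff_norm]
      rcases le_total 0 t with ht | ht
      · have := hbd N 0 t ht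
        rw [hX0] at this
        refine this.trans ?_
        rw [abs_of_nonneg ht]
        gcongr
        linarith
      · have := hbd N t 0 ht
        rw [hX0, norm_sub_rev] at this
        refine this.trans ?_
        rw [abs_of_nonpos ht]
        gcongr
        linarith
    obtain ⟨y, -, hy⟩ := (isCompact_closedBall x₀ (M * (|t| + 1))).ultrafilter_le_nhds
      ((hyperfilter ℕ).map fun N => X N t) 
        (le_principal_iff.2 (mem_map.2 (Eventually.of_forall hmem)))
    exact ⟨y, hy⟩
  choose x hx using hlim
  have hcof : (hyperfilter ℕ : Filter ℕ) ≤ atTop := by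
    simpa [Nat.cofinite_eq_atTop] using (hyperfilter_le_cofinite (α := ℕ))
  have hinv : Tendsto (fun N : ℕ => ((N : ℝ) + 1)⁻¹) (hyperfilter ℕ) (𝓝 0) := by
    have := tendsto_one_div_add_atTop_nhds_zero_nat (𝕜 := ℝ)
    simp only [one_div] at this
    exact this.mono_left hcof
  refine ⟨x, ?_, ?_, ?_⟩
  · have := hx 0
    simp only [hX0] at this
    exact tendsto_nhds_unique this tendsto_const_nhds
  · refine LipschitzWith.of_dist_le_mul fun s t => ?_
    wlog hst : t ≤ s generalizing s t
    · rw [dist_comm, dist_comm s]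
      exact this t s (le_of_not_ge hst)
    rw [dist_eq_norm, Real.dist_eq, abs_of_nonneg (sub_nonneg.2 hst)]
    have h1 := ((hx s).sub (hx t)).norm
    have h2 : Tendsto (fun N : ℕ => (M : ℝ) * (s - t + ((N : ℝ) + 1)⁻¹)) (hyperfilter ℕ)
        (𝓝 (M * (s - t + 0))) := (hinv.const_add _).const_mul _
    rw [add_zero] at h2
    exact le_of_tendsto_of_tendsto' h1 h2 fun N => hbd N t s hst
  · intro a b δ ha hab hδ C hC hconv hCg
    -- The time that the scheme really spends between the grid points below a and b; dividing by it
    -- instead of b - a makes the quotient an exact average of values of `g`.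
    set r : ℕ → ℝ := fun N =>
      ((N : ℝ) + 1)⁻¹ * ((⌊((N : ℝ) + 1) * b⌋₊ : ℝ) - ⌊((N : ℝ) + 1) * a⌋₊) with hr
    have hfloor : ∀ c : ℝ, 0 ≤ c → Tendsto (fun N : ℕ => ((N : ℝ) + 1)⁻¹ *
        (⌊((N : ℝ) + 1) * c⌋₊ : ℝ)) (hyperfilter ℕ) (𝓝 c) := by
      intro c hc
      have h1 : Tendsto (fun N : ℕ => c - ((N : ℝ) + 1)⁻¹) (hyperfilter ℕ) (𝓝 (c - 0)) :=
        hinv.const_sub c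
      rw [sub_zero] at h1
      refine tendsto_of_tendsto_of_tendsto_of_le_of_le h1 tendsto_const_nhds (fun N => ?_)
        (fun N => ?_)
      · have hN : (0 : ℝ) < N + 1 := by positivity
        have h2 : ((N : ℝ) + 1) * c < ⌊((N : ℝ) + 1) * c⌋₊ + 1 := Nat.lt_floor_add_one _
        simp only []
        rw [le_inv_mul_iff₀ hN]
        have : ((N : ℝ) + 1) * (c - ((N : ℝ) + 1)⁻¹) = ((N : ℝ) + 1) * c - 1 := by field_simp
        linarith
      · have hN : (0 : ℝ) < N + 1 := by positivity
        simp only []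
        rw [inv_mul_le_iff₀ hN]
        exact Nat.floor_le (by positivity)
    have hrlim : Tendsto r (hyperfilter ℕ) (𝓝 (b - a)) := by
      have := (hfloor b (ha.trans hab.le)).sub (hfloor a ha)
      refine this.congr fun N => ?_
      simp only [hr]; ring
    have hba : 0 < b - a := sub_pos.2 hab
    have hlim : Tendsto (fun N => (r N)⁻¹ • (X N b - X N a)) (hyperfilter ℕ)
        (𝓝 ((b - a)⁻¹ • (x b - x a))) :=
      (hrlim.inv₀ hba.ne').smul ((hx b).sub (hx a))
    refine hC.mem_of_tendsto hlim ?_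
    have hclose : ∀ᶠ N in (hyperfilter ℕ : Filter ℕ),
        dist (X N a) (x a) + M * (b - a + ((N : ℝ) + 1)⁻¹) < δ := by
      have h1 : Tendsto (fun N : ℕ => dist (X N a) (x a) + M * (b - a + ((N : ℝ) + 1)⁻¹))
          (hyperfilter ℕ) (𝓝 (0 + M * (b - a + 0))) :=
        ((tendsto_iff_dist_tendsto_zero.1 (hx a))).add ((hinv.const_add _).const_mul _)
      refine h1.eventually_lt_const ?_
      simpa using hδ
    filter_upwards [hclose, hrlim.eventually (lt_mem_nhds hba)] with N hN hrN
    set p := ⌊((N : ℝ) + 1) * a⌋₊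
    set q := ⌊((N : ℝ) + 1) * b⌋₊
    have hpq : p ≤ q := hfl N a b hab.le
    have hNpos : (0 : ℝ) < N + 1 := by positivity
    have hqp : (0 : ℝ) < (q : ℝ) - p := by
      have : r N = ((N : ℝ) + 1)⁻¹ * ((q : ℝ) - p) := rfl
      rw [this] at hrN
      exact pos_of_mul_pos_right hrN (by positivity)
    have hsum : (r N)⁻¹ • (X N b - X N a) =
        ∑ m ∈ Finset.Ico p q, ((q : ℝ) - p)⁻¹ • g (eulerIterate g x₀ ((N : ℝ) + 1)⁻¹ m) := by
      have h1 : X N b - X N a = _ := eulerIterate_sub g x₀ ((N : ℝ) + 1)⁻¹ hpq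
      rw [h1, smul_smul, ← Finset.smul_sum]
      congr 1
      change (((N : ℝ) + 1)⁻¹ * ((q : ℝ) - p))⁻¹ * ((N : ℝ) + 1)⁻¹ = _
      field_simp
    rw [hsum]
    refine hconv.sum_mem (fun _ _ => by positivity) ?_ fun m hm => hCg _ ?_
    · rw [Finset.sum_const, Nat.card_Ico, nsmul_eq_mul, Nat.cast_sub hpq]
      exact mul_inv_cancel₀ hqp.ne'
    · rw [Finset.mem_Ico] at hm
      have h1 := norm_eulerIterate_sub_le hM x₀ (hη N).le hm.1
      have h2 : ((N : ℝ) + 1)⁻¹ * ((m : ℝ) - p) ≤ ((N : ℝ) + 1)⁻¹ * ((q : ℝ) - p) := by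
        have : (m : ℝ) ≤ q := by exact_mod_cast hm.2.le
        gcongr
      have h3 := h2.trans (hlen N a b hab.le)
      rw [Metric.mem_ball]
      refine (dist_triangle _ (X N a) _).trans_lt ?_
      rw [dist_eq_norm]
      have h4 : ‖eulerIterate g x₀ ((N : ℝ) + 1)⁻¹ m - X N a‖ ≤
          M * (b - a + ((N : ℝ) + 1)⁻¹) :=
        h1.trans (mul_le_mul_of_nonneg_left h3 M.2)
      linarith

/-- Derivatives of the curve in `exists_lipschitzWith_slope_mem` lie in the closed convex hull of
the nearby values. -/
theorem mem_of_hasDerivAt_of_slope_mem {x : ℝ → E} {C : Set E} {t δ : ℝ} {v : E}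
    (hC : IsClosed C) (hv : HasDerivAt x v t) (hδ : 0 < δ)
    (h : ∀ s, t < s → s < t + δ → (s - t)⁻¹ • (x s - x t) ∈ C) : v ∈ C := by
  have h1 := hv.hasDerivWithinAt (s := Ioi t)
  rw [hasDerivWithinAt_iff_tendsto_slope' (by simp)] at h1
  refine hC.mem_of_tendsto h1 ?_
  filter_upwards [Ioo_mem_nhdsGT (show t < t + δ by linarith)] with s hs
  simpa [slope_def_module] using h s hs.1 hs.2

/-- **Peano's theorem** on the half-line for a bounded continuous vector field. -/
theorem exists_hasDerivAt_of_continuous_of_bounded [FiniteDimensional ℝ E] {g : E → E} {M : ℝ≥0}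
    (hg : Continuous g) (hM : ∀ x, ‖g x‖ ≤ M) (x₀ : E) :
    ∃ x : ℝ → E, x 0 = x₀ ∧ LipschitzWith M x ∧ ∀ t, 0 < t → HasDerivAt x (g (x t)) t := by
  obtain ⟨x, hx0, hxL, hx⟩ := exists_lipschitzWith_slope_mem hM x₀
  refine ⟨x, hx0, hxL, fun t ht => ?_⟩
  rw [hasDerivAt_iff_tendsto_slope, Metric.tendsto_nhds]
  intro ε hε
  obtain ⟨δ, hδ, hball⟩ := Metric.continuousAt_iff.1 (hg.continuousAt (x := x t)) (ε / 2)
    (half_pos hε)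
  have hMn : (0 : ℝ) ≤ M := M.2
  -- Half of δ is for the ball around `x a`, the other half for the motion of `x` from a to t.
  -- Letting t be either endpoint gives both one-sided slopes.
  have key : ∀ a b, 0 ≤ a → a < b → a ≤ t → t ≤ b → b - a < δ / (2 * (M + 1)) →
      (b - a)⁻¹ • (x b - x a) ∈ Metric.closedBall (g (x t)) (ε / 2) := by
    intro a b ha hab hat htb hlt
    rw [lt_div_iff₀ (by positivity)] at hlt
    refine hx a b (δ / 2) ha hab ?_ _ Metric.isClosed_closedBall (convex_closedBall _ _) ?_
    · nlinarith
    · intro y hy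
      refine Metric.mem_closedBall.2 (hball ?_).le
      refine (dist_triangle y (x a) (x t)).trans_lt ?_
      have h1 := hxL.dist_le_mul a t
      rw [Real.dist_eq, abs_of_nonpos (by linarith)] at h1
      have h2 := Metric.mem_ball.1 hy
      nlinarith
  have hρ : 0 < min t (δ / (2 * (M + 1))) := lt_min ht (by positivity)
  have hnhds : Metric.ball t (min t (δ / (2 * (M + 1)))) ∈ 𝓝[≠] t :=
    mem_nhdsWithin_of_mem_nhds (Metric.ball_mem_nhds _ hρ)
  filter_upwards [hnhds, self_mem_nhdsWithin] with s hs hne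
  rw [Metric.mem_ball, Real.dist_eq, lt_min_iff] at hs
  have hfin : slope x t s ∈ Metric.closedBall (g (x t)) (ε / 2) := by
    rcases lt_or_gt_of_ne hne with hlt | hlt
    · rw [abs_of_neg (by linarith)] at hs
      rw [slope_comm]
      simpa [slope_def_module] using key s t (by linarith) hlt hlt.le le_rfl (by linarith)
    · rw [abs_of_pos (by linarith)] at hs
      simpa [slope_def_module] using key t s ht.le hlt le_rfl hlt.le (by linarith)
  exact (Metric.mem_closedBall.1 hfin).trans_lt (half_lt_self hε)

end Euler

/-! ### The Filippov map -/

/-- The complement of a null set is dense, so discarding `S` cannot remove the value at a continuity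
point from the closure. -/
theorem ContinuousAt.mem_closure_image_ball_diff {X Y : Type*} [PseudoMetricSpace X]
    [MeasureSpace X] [(volume : Measure X).IsOpenPosMeasure] [TopologicalSpace Y]
    {f : X → Y} {x y : X} {δ : ℝ} {S : Set X} (hf : ContinuousAt f y)
    (hy : y ∈ Metric.ball x δ) (hS : volume S = 0) :
    f y ∈ closure (f '' (Metric.ball x δ \ S)) := by
  have hdense : Dense Sᶜ := Measure.dense_of_ae (measure_eq_zero_iff_ae_notMem.1 hS)
  have h1 : y ∈ closure (Metric.ball x δ \ S) := by
    rw [sdiff_eq]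
    exact hdense.open_subset_closure_inter Metric.isOpen_ball hy
  exact mem_closure_image hf h1

section FilippovMap

variable {E : Type*} [NormedAddCommGroup E] [NormedSpace ℝ E] [MeasureSpace E]

theorem mem_filippovMap_iff {f : E → E} {x v : E} :
    v ∈ filippovMap f x ↔ ∀ δ : ℝ, 0 < δ → ∀ S : Set E, volume S = 0 →
      v ∈ closure (convexHull ℝ (f '' (Metric.ball x δ \ S))) := by
  simp [filippovMap]

theorem filippovMap_subset {f : E → E} {x : E} {C S : Set E} {δ : ℝ} (hC : IsClosed C)
    (hconv : Convex ℝ C) (hδ : 0 < δ) (hS : volume S = 0)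
    (h : ∀ y ∈ Metric.ball x δ \ S, f y ∈ C) : filippovMap f x ⊆ C := fun v hv => by
  have := mem_filippovMap_iff.1 hv δ hδ S hS
  exact closure_minimal (convexHull_min (image_subset_iff.2 h) hconv) hC this

theorem filippovMap_subset_of_eventually {f : E → E} {x : E} {C : Set E} (hC : IsClosed C)
    (hconv : Convex ℝ C) (h : ∀ᶠ y in 𝓝 x, f y ∈ C) : filippovMap f x ⊆ C := by
  obtain ⟨δ, hδ, hb⟩ := Metric.eventually_nhds_iff_ball.1 h
  exact filippovMap_subset hC hconv hδ (measure_empty (μ := volume)) fun y hy => hb y hy.1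

theorem convex_filippovMap (f : E → E) (x : E) : Convex ℝ (filippovMap f x) :=
  convex_iInter fun _ => convex_iInter fun _ => convex_iInter fun _ =>
    convex_iInter fun _ => (convex_convexHull ℝ _).closure

/-- A form of upper semicontinuity: it lets one selection of the Filippov map serve every null set
`S` at once. -/
theorem filippovMap_subset_closure_convexHull {f : E → E} {x y : E} {δ : ℝ}
    (hy : y ∈ Metric.ball x δ) {S : Set E} (hS : volume S = 0) :
    filippovMap f y ⊆ closure (convexHull ℝ (f '' (Metric.ball x δ \ S))) := by
  obtain ⟨ε, hε, hsub⟩ := Metric.isOpen_iff.1 Metric.isOpen_ball y hy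
  refine filippovMap_subset isClosed_closure (convex_convexHull ℝ _).closure hε hS fun z hz => ?_
  exact subset_closure (subset_convexHull ℝ _ ⟨z, ⟨hsub hz.1, hz.2⟩, rfl⟩)

/-- Limits of values at points of continuity belong to the Filippov map. -/
theorem mem_filippovMap_of_tendsto [(volume : Measure E).IsOpenPosMeasure] {ι : Type*}
    {l : Filter ι} [l.NeBot] {f : E → E} {x v : E} {y : ι → E} (hy : Tendsto y l (𝓝 x))
    (hc : ∀ᶠ i in l, ContinuousAt f (y i)) (hv : Tendsto (fun i => f (y i)) l (𝓝 v)) :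
    v ∈ filippovMap f x := by
  refine mem_filippovMap_iff.2 fun δ hδ S hS => ?_
  refine isClosed_closure.mem_of_tendsto hv ?_
  filter_upwards [hc, hy.eventually (Metric.ball_mem_nhds x hδ)] with i hi hyi
  exact closure_mono (subset_convexHull ℝ _) (hi.mem_closure_image_ball_diff hyi hS)

/-- By compactness, the bounded values of `f` have a limit along an ultrafilter of continuity points
tending to x. -/
theorem filippovMap_nonempty [(volume : Measure E).IsOpenPosMeasure] [FiniteDimensional ℝ E]
    {f : E → E} (hdense : Dense {y | ContinuousAt f y}) {x : E} {M : ℝ}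
    (hM : ∀ᶠ y in 𝓝 x, ‖f y‖ ≤ M) : (filippovMap f x).Nonempty := by
  have : ProperSpace E := FiniteDimensional.proper ℝ E
  have hne : (𝓝[{y | ContinuousAt f y}] x).NeBot :=
    mem_closure_iff_nhdsWithin_neBot.1 (hdense x)
  set U := Ultrafilter.of (𝓝[{y | ContinuousAt f y}] x)
  have hU : (U : Filter E) ≤ 𝓝[{y | ContinuousAt f y}] x := Ultrafilter.of_le _
  have hball : ∀ᶠ y in (U : Filter E), f y ∈ Metric.closedBall (0 : E) M := by
    filter_upwards [(hU.trans nhdsWithin_le_nhds) hM] with y hy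
    exact mem_closedBall_zero_iff.2 hy
  obtain ⟨v, -, hv⟩ := (isCompact_closedBall (0 : E) M).ultrafilter_le_nhds (U.map f)
    (le_principal_iff.2 (mem_map.2 hball))
  exact ⟨v, mem_filippovMap_of_tendsto (y := id) (hU.trans nhdsWithin_le_nhds)
    (hU self_mem_nhdsWithin) hv⟩

/-- A `C¹` curve whose derivative lies in the Filippov map is a maximal solution. -/
theorem IsMaximalFilippovSolution.of_hasDerivAt {f : E → E} {x : ℝ → E} {K : ℝ≥0}
    (hL : LipschitzWith K x)
    (h : ∀ t, 0 < t → ∃ v ∈ filippovMap f (x t), HasDerivAt x v t) :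
    IsMaximalFilippovSolution f ⊤ x where
  isSolution :=
    { pos := by simp
      absCont := fun s _ _ =>
        (hL.lipschitzOnWith (s := uIcc 0 s)).absolutelyContinuousOnInterval
      inclusion := Eventually.of_forall fun t ht _ => h t ht }
  not_extendable := fun T' _ hT' _ => absurd hT' (by simp)

end FilippovMap

/-! ### Existence, extension and integration of Filippov solutions -/

section FilippovSolution

variable {E : Type*} [NormedAddCommGroup E] [NormedSpace ℝ E] [FiniteDimensional ℝ E]
  [MeasureSpace E]

-- Euler's method is run on an arbitrary selection of the Filippov map, set to zero outside the
-- ball. The slopes of the limit curve lie in every closed convex set that defines the map, hence so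
-- do its derivatives.
open Classical in
theorem exists_lipschitzWith_hasDerivAt_mem_filippovMap
    [(volume : Measure E).IsOpenPosMeasure] {f : E → E}
    (hdense : Dense {y | ContinuousAt f y}) {x₀ : E} {R : ℝ} (hR : 0 < R) {M : ℝ≥0}
    (hM : ∀ y ∈ Metric.ball x₀ R, ‖f y‖ ≤ M) :
    ∃ η : ℝ, 0 < η ∧ ∃ x : ℝ → E, x 0 = x₀ ∧ LipschitzWith M x ∧
      ∀ t, 0 ≤ t → t < η → ∀ v, HasDerivAt x v t → v ∈ filippovMap f (x t) := by
  have hev : ∀ y ∈ Metric.ball x₀ R, ∀ᶠ z in 𝓝 y, ‖f z‖ ≤ M := fun y hy => by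
    filter_upwards [Metric.isOpen_ball.mem_nhds hy] with z hz using hM z hz
  have hne : ∀ y ∈ Metric.ball x₀ R, ∃ v, v ∈ filippovMap f y := fun y hy =>
    filippovMap_nonempty hdense (hev y hy)
  choose! s hs using hne
  set g : E → E := fun y => if y ∈ Metric.ball x₀ R then s y else 0
  have hg : ∀ y, ‖g y‖ ≤ M := by
    intro y
    by_cases hy : y ∈ Metric.ball x₀ R
    · have h1 : filippovMap f y ⊆ Metric.closedBall 0 (M : ℝ) :=
        filippovMap_subset_of_eventually Metric.isClosed_closedBall (convex_closedBall _ _)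
          (by simpa using hev y hy)
      simpa only [g, if_pos hy, mem_closedBall_zero_iff] using h1 (hs y hy)
    · simp only [g, if_neg hy, norm_zero, NNReal.coe_nonneg]
  obtain ⟨x, hx0, hxL, hx⟩ := exists_lipschitzWith_slope_mem hg x₀
  have hMn : (0 : ℝ) ≤ M := M.2
  -- At speed at most M the curve cannot leave the ball of radius R before this time.
  refine ⟨R / (M + 1), by positivity, x, hx0, hxL, fun t ht htη v hv => ?_⟩
  have hxt : x t ∈ Metric.ball x₀ R := by
    rw [Metric.mem_ball, ← hx0]
    have := hxL.dist_le_mul t 0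
    rw [Real.dist_eq, sub_zero, abs_of_nonneg ht] at this
    rw [lt_div_iff₀ (by positivity)] at htη
    nlinarith
  obtain ⟨ρ, hρ, hsub⟩ := Metric.isOpen_iff.1 Metric.isOpen_ball _ hxt
  refine mem_filippovMap_iff.2 fun δ hδ S hS => ?_
  refine mem_of_hasDerivAt_of_slope_mem isClosed_closure hv
    (δ := min δ ρ / (M + 1)) (by have := lt_min hδ hρ; positivity) fun b htb hbt => ?_
  refine hx t b (min δ ρ) ht htb ?_ _ isClosed_closure (convex_convexHull ℝ _).closure ?_
  · have h1 : b - t < min δ ρ / (M + 1) := by linarith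
    rw [lt_div_iff₀ (by positivity)] at h1
    nlinarith
  · intro y hy
    have hy1 : y ∈ Metric.ball x₀ R := hsub (Metric.ball_subset_ball (min_le_right _ _) hy)
    have hy2 : y ∈ Metric.ball (x t) δ := Metric.ball_subset_ball (min_le_left _ _) hy
    have hgy : g y = s y := if_pos hy1
    rw [hgy]
    exact filippovMap_subset_closure_convexHull hy2 hS (hs y hy1)

/-- A Lipschitz Filippov solution on a bounded interval extends to a larger interval. -/
theorem IsFilippovSolution.exists_extension [(volume : Measure E).IsOpenPosMeasure] {f : E → E}
    (hdense : Dense {y | ContinuousAt f y})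
    (hbdd : ∀ x₀, ∃ R > 0, ∃ M : ℝ≥0, ∀ y ∈ Metric.ball x₀ R, ‖f y‖ ≤ M)
    {τ : ℝ} {x : ℝ → E} (hx : IsFilippovSolution f (τ : EReal) x) {K : ℝ≥0}
    (hK : LipschitzOnWith K x (Ico 0 τ)) :
    ∃ η : ℝ, 0 < η ∧ ∃ y : ℝ → E, IsFilippovSolution f ((τ + η : ℝ) : EReal) y ∧
      ∀ t, 0 ≤ t → t < τ → y t = x t := by
  have hτ : 0 < τ := by exact_mod_cast hx.pos
  -- The value of `x` at τ is arbitrary; a Lipschitz extension supplies the correct endpoint from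
  -- which to restart.
  obtain ⟨X, hXL, hX⟩ := hK.extend_finite_dimension
  set K' := lipschitzExtensionConstant E * K
  obtain ⟨R, hR, M, hM⟩ := hbdd (X τ)
  obtain ⟨η, hη, z, hz0, hzL, hz⟩ :=
    exists_lipschitzWith_hasDerivAt_mem_filippovMap hdense hR hM
  set y : ℝ → E := fun t => if t < τ then X t else z (t - τ) with hy
  have hyl : ∀ t, t < τ → y t = X t := fun t ht => if_pos ht
  have hyr : ∀ t, τ ≤ t → y t = z (t - τ) := fun t ht => if_neg (not_lt.2 ht)
  have hyL : LipschitzWith (K' + M) y := by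
    refine LipschitzWith.of_dist_le_mul fun s t => ?_
    wlog hst : s ≤ t generalizing s t
    · rw [dist_comm, dist_comm s]
      exact this t s (le_of_not_ge hst)
    have hKn : (0 : ℝ) ≤ K' := K'.2
    have hMn : (0 : ℝ) ≤ M := M.2
    rw [Real.dist_eq, abs_of_nonpos (by linarith), NNReal.coe_add]
    rcases lt_or_ge s τ with hs | hs
    · rw [hyl s hs]
      rcases lt_or_ge t τ with ht | ht
      · rw [hyl t ht]
        have := hXL.dist_le_mul s t
        rw [Real.dist_eq, abs_of_nonpos (by linarith)] at this
        nlinarith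
      · rw [hyr t ht]
        have h1 := hXL.dist_le_mul s τ
        have h2 := hzL.dist_le_mul 0 (t - τ)
        rw [Real.dist_eq, abs_of_nonpos (by linarith)] at h1 h2
        rw [hz0] at h2
        have h3 := dist_triangle (X s) (X τ) (z (t - τ))
        nlinarith
    · rw [hyr s hs, hyr t (hs.trans hst)]
      have := hzL.dist_le_mul (s - τ) (t - τ)
      rw [Real.dist_eq, abs_of_nonpos (by linarith)] at this
      nlinarith
  refine ⟨η, hη, y, ⟨?_, ?_, ?_⟩, fun t ht0 htτ => ?_⟩
  · exact_mod_cast (by linarith : 0 < τ + η)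
  · intro s _ _
    exact (hyL.lipschitzOnWith (s := uIcc 0 s)).absolutelyContinuousOnInterval
  · have hne : ∀ᵐ t : ℝ, t ≠ τ := by simp [ae_iff, measure_singleton]
    filter_upwards [hx.inclusion, hyL.ae_differentiableAt_real, hne] with t hxt hyt htne ht0 htT
    have htT' : t < τ + η := by exact_mod_cast htT
    rcases lt_or_gt_of_ne htne with hlt | hgt
    · obtain ⟨v, hv, hd⟩ := hxt ht0 (by exact_mod_cast hlt)
      have heq : y =ᶠ[𝓝 t] x := by
        filter_upwards [Ioo_mem_nhds ht0 hlt] with r hr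
        rw [hyl r hr.2, hX ⟨hr.1.le, hr.2⟩]
      exact ⟨v, by rwa [heq.eq_of_nhds], hd.congr_of_eventuallyEq heq⟩
    · refine ⟨deriv y t, ?_, hyt.hasDerivAt⟩
      rw [hyr t hgt.le]
      refine hz _ (by linarith) (by linarith) _ ?_
      have heq : (fun r => y (r + τ)) =ᶠ[𝓝 (t - τ)] z := by
        filter_upwards [Ioi_mem_nhds (show 0 < t - τ by linarith)] with r hr
        have hr' : 0 < r := hr
        rw [hyr (r + τ) (by linarith), add_sub_cancel_right]
      have h1 : HasDerivAt y (deriv y t) (t - τ + τ) := by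
        rw [sub_add_cancel]; exact hyt.hasDerivAt
      exact (h1.comp_add_const (t - τ) τ).congr_of_eventuallyEq heq.symm
  · rw [hyl t htτ, hX ⟨ht0, htτ⟩]

theorem IsMaximalFilippovSolution.eq_top [(volume : Measure E).IsOpenPosMeasure] {f : E → E}
    (hdense : Dense {y | ContinuousAt f y})
    (hbdd : ∀ x₀, ∃ R > 0, ∃ M : ℝ≥0, ∀ y ∈ Metric.ball x₀ R, ‖f y‖ ≤ M)
    {T : EReal} {x : ℝ → E} (hx : IsMaximalFilippovSolution f T x) {K : ℝ≥0}
    (hK : LipschitzOnWith K x {t | 0 ≤ t ∧ (t : EReal) < T}) : T = ⊤ := by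
  by_contra hT
  have hpos := hx.isSolution.pos
  lift T to ℝ using ⟨hT, fun h => by simp [h] at hpos⟩
  have hset : {t : ℝ | 0 ≤ t ∧ (t : EReal) < T} = Ico 0 T := by ext t; simp
  rw [hset] at hK
  obtain ⟨η, hη, y, hy, hyx⟩ := hx.isSolution.exists_extension hdense hbdd hK
  refine hx.not_extendable _ y ?_ hy fun t ht htT => hyx t ht (by exact_mod_cast htT)
  exact_mod_cast (by linarith : T < T + η)

/-- The integrated Lyapunov inequality: V ∘ x is absolutely continuous, so an almost everywhere
bound on its derivative integrates. It is used for the energy and for linear functionals. -/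
theorem IsFilippovSolution.sub_le_mul_of_fderiv_le {f : E → E} {T : EReal} {x : ℝ → E}
    (hx : IsFilippovSolution f T x) {V : E → ℝ} (hV : ContDiff ℝ 1 V) {a b c : ℝ} (ha : 0 ≤ a)
    (hab : a ≤ b) (hb : (b : EReal) < T)
    (h : ∀ t, a < t → t < b → ∀ v ∈ filippovMap f (x t), fderiv ℝ V (x t) v ≤ c) :
    V (x b) - V (x a) ≤ c * (b - a) := by
  have hac : AbsolutelyContinuousOnInterval (V ∘ x) a b :=
    hV.comp_absolutelyContinuousOnInterval ((hx.absCont b (ha.trans hab) hb).mono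
      (by rw [uIcc_of_le hab, uIcc_of_le (ha.trans hab)]; exact Icc_subset_Icc_left ha))
  refine hac.sub_le_mul_of_ae_hasDerivAt_le hab ?_
  filter_upwards [hx.inclusion] with t ht hat htb
  obtain ⟨v, hv, hd⟩ := ht (ha.trans_lt hat) (lt_trans (by exact_mod_cast htb) hb)
  exact ⟨_, h t hat htb v hv,
    ((hV.differentiable (by simp)) (x t)).hasFDerivAt.comp_hasDerivAt t hd⟩

end FilippovSolution

/-! ### The Laplacian of a connected weighted graph -/

section Laplacian

variable {n k : ℕ}

/-- A symmetric, nonnegative weight matrix whose positive entries connect all indices. -/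
structure IsConnectedWeights (A : Matrix (Fin n) (Fin n) ℝ) : Prop where
  symm : ∀ i j, A i j = A j i
  nonneg : ∀ i j, 0 ≤ A i j
  connected : ∀ z : Fin n → ℝ, (∀ i j, 0 < A i j → z i = z j) → ∀ i j, z i = z j

theorem isConnectedWeights_weightedAdj {G : SimpleGraph (Fin n)} (hG : G.Connected)
    {w : Fin n → Fin n → ℝ} (hw_symm : ∀ i j, G.Adj i j → w i j = w j i)
    (hw_pos : ∀ i j, G.Adj i j → 0 < w i j) : IsConnectedWeights (weightedAdj G w) where
  symm i j := by
    by_cases h : G.Adj i j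
    · simp [weightedAdj, h, h.symm, hw_symm i j h]
    · have h' : ¬G.Adj j i := fun h' => h h'.symm
      simp [weightedAdj, h, h']
  nonneg i j := by
    by_cases h : G.Adj i j
    · simpa [weightedAdj, h] using (hw_pos i j h).le
    · simp [weightedAdj, h]
  connected z hz i j := by
    obtain ⟨p⟩ := hG.preconnected i j
    induction p with
    | nil => rfl
    | cons h _ ih => exact (hz _ _ (by simpa [weightedAdj, h] using hw_pos _ _ h)).trans ih

/-- The negative Laplacian `x ↦ -(L ⊗ I) x` on the state space. -/
def relativeMap (k : ℕ) (A : Matrix (Fin n) (Fin n) ℝ) :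
    AgentState n k →L[ℝ] AgentState n k :=
  LinearMap.toContinuousLinearMap
    { toFun := fun x => WithLp.toLp 2 fun p => relativeState A x p.1 p.2
      map_add' := fun x y => by
        ext p
        simp only [relativeState, PiLp.add_apply, ← Finset.sum_add_distrib]
        exact Finset.sum_congr rfl fun j _ => by ring
      map_smul' := fun c x => by
        ext p
        simp only [relativeState, PiLp.smul_apply, smul_eq_mul, RingHom.id_apply, Finset.mul_sum]
        exact Finset.sum_congr rfl fun j _ => by ring }

theorem relativeMap_apply (A : Matrix (Fin n) (Fin n) ℝ) (x : AgentState n k)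
    (p : Fin n × Fin k) :
    relativeMap k A x p = ∑ j, A p.1 j * (x (j, p.2) - x p) := rfl

theorem inner_agentState (x y : AgentState n k) : ⟪x, y⟫ = ∑ p, x p * y p := by
  simp [PiLp.inner_apply, mul_comm]

theorem norm_sq_agentState (x : AgentState n k) : ‖x‖ ^ 2 = ∑ p, x p ^ 2 := by
  simp [EuclideanSpace.norm_sq_eq]

theorem abs_apply_le_norm (x : AgentState n k) (p : Fin n × Fin k) : |x p| ≤ ‖x‖ :=
  PiLp.norm_apply_le x p

theorem exists_norm_le_of_forall_abs_le (n k : ℕ) :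
    ∃ C : ℝ≥0, ∀ (x : AgentState n k) (r : ℝ), 0 ≤ r → (∀ p, |x p| ≤ r) → ‖x‖ ≤ C * r := by
  set e := (EuclideanSpace.equiv (Fin n × Fin k) ℝ).symm
  refine ⟨‖(e : (Fin n × Fin k → ℝ) →L[ℝ] AgentState n k)‖₊, fun x r hr h => ?_⟩
  have h1 := (e : (Fin n × Fin k → ℝ) →L[ℝ] AgentState n k).le_opNorm (fun p => x p)
  refine h1.trans (mul_le_mul_of_nonneg_left ?_ (norm_nonneg _))
  exact (pi_norm_le_iff_of_nonneg hr).2 h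

theorem relativeMap_consensusState (A : Matrix (Fin n) (Fin n) ℝ) (c : Fin k → ℝ) :
    relativeMap k A (consensusState n c) = 0 := by
  ext p
  simp [relativeMap_apply, consensusState]

namespace IsConnectedWeights

variable {A : Matrix (Fin n) (Fin n) ℝ}

/-- Summation by parts: exchange the two agents in the double sum and use the symmetry of the
weights. -/
theorem inner_relativeMap (hA : IsConnectedWeights A) (x y : AgentState n k) :
    ⟪relativeMap k A x, y⟫ =
      -(∑ p : Fin n × Fin k, ∑ j, A p.1 j * (x (j, p.2) - x p) * (y (j, p.2) - y p)) / 2 := by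
  have h1 : ⟪relativeMap k A x, y⟫ =
      ∑ p : Fin n × Fin k, ∑ j, A p.1 j * (x (j, p.2) - x p) * y p := by
    rw [inner_agentState]
    simp only [relativeMap_apply, Finset.sum_mul]
  have h2 : ∑ p : Fin n × Fin k, ∑ j, A p.1 j * (x (j, p.2) - x p) * y p =
      -∑ p : Fin n × Fin k, ∑ j, A p.1 j * (x (j, p.2) - x p) * y (j, p.2) := by
    rw [Fintype.sum_prod_type_right, Fintype.sum_prod_type_right, ← Finset.sum_neg_distrib]
    refine Finset.sum_congr rfl fun l _ => ?_
    rw [Finset.sum_comm, ← Finset.sum_neg_distrib]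
    refine Finset.sum_congr rfl fun i _ => ?_
    rw [← Finset.sum_neg_distrib]
    refine Finset.sum_congr rfl fun j _ => ?_
    rw [hA.symm]; ring
  have h3 : ∑ p : Fin n × Fin k, ∑ j, A p.1 j * (x (j, p.2) - x p) * (y (j, p.2) - y p) =
      ∑ p : Fin n × Fin k, ∑ j, A p.1 j * (x (j, p.2) - x p) * y (j, p.2) -
        ∑ p : Fin n × Fin k, ∑ j, A p.1 j * (x (j, p.2) - x p) * y p := by
    simp only [← Finset.sum_sub_distrib, mul_sub]
  rw [h3, h1]
  linarith

theorem inner_relativeMap_comm (hA : IsConnectedWeights A) (x y : AgentState n k) :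
    ⟪relativeMap k A x, y⟫ = ⟪relativeMap k A y, x⟫ := by
  rw [hA.inner_relativeMap, hA.inner_relativeMap]
  congr 3
  funext p
  exact Finset.sum_congr rfl fun j _ => by ring

/-- U is self-adjoint and annihilates consensus states; test it against the one in direction l. -/
theorem sum_relativeMap (hA : IsConnectedWeights A) (x : AgentState n k) (l : Fin k) :
    ∑ i, relativeMap k A x (i, l) = 0 := by
  have h := hA.inner_relativeMap_comm x (consensusState n (Pi.single l 1))
  rw [relativeMap_consensusState, inner_zero_left, inner_agentState,
    Fintype.sum_prod_type_right] at h
  rw [← h, Finset.sum_eq_single l]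
  · simp [consensusState]
  · intro l' _ hl'
    simp [consensusState, hl']
  · simp

theorem inner_relativeMap_self_nonpos (hA : IsConnectedWeights A) (x : AgentState n k) :
    ⟪relativeMap k A x, x⟫ ≤ 0 := by
  rw [hA.inner_relativeMap]
  have : 0 ≤ ∑ p : Fin n × Fin k, ∑ j, A p.1 j * (x (j, p.2) - x p) * (x (j, p.2) - x p) :=
    Finset.sum_nonneg fun p _ => Finset.sum_nonneg fun j _ => by
      rw [mul_assoc]
      exact mul_nonneg (hA.nonneg _ _) (mul_self_nonneg _)
  linarith

theorem eq_of_inner_relativeMap_self_eq_zero (hA : IsConnectedWeights A) {x : AgentState n k}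
    (h : ⟪relativeMap k A x, x⟫ = 0) (i j : Fin n) (l : Fin k) : x (i, l) = x (j, l) := by
  rw [hA.inner_relativeMap] at h
  have hnn : ∀ (p : Fin n × Fin k) (j : Fin n),
      0 ≤ A p.1 j * (x (j, p.2) - x p) * (x (j, p.2) - x p) := fun p j => by
    rw [mul_assoc]
    exact mul_nonneg (hA.nonneg _ _) (mul_self_nonneg _)
  have h0 : ∑ p : Fin n × Fin k, ∑ j, A p.1 j * (x (j, p.2) - x p) * (x (j, p.2) - x p) = 0 := by
    linarith
  rw [Finset.sum_eq_zero_iff_of_nonneg fun p _ => Finset.sum_nonneg fun j _ => hnn p j] at h0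
  refine hA.connected (fun i => x (i, l)) (fun i j hij => ?_) i j
  have h1 := h0 (i, l) (Finset.mem_univ _)
  rw [Finset.sum_eq_zero_iff_of_nonneg fun j _ => hnn _ j] at h1
  have h2 := h1 j (Finset.mem_univ _)
  rw [mul_assoc] at h2
  have h3 := mul_self_eq_zero.1 ((mul_eq_zero.1 h2).resolve_left hij.ne')
  simpa using (sub_eq_zero.1 h3).symm

end IsConnectedWeights

open Classical in
/-- The map that keeps the coordinates of the agents in `J` and applies the negative Laplacian in
the coordinates of the other agents. -/
def mixedMap (A : Matrix (Fin n) (Fin n) ℝ) (J : Finset (Fin n)) :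
    AgentState n k →ₗ[ℝ] AgentState n k where
  toFun x := WithLp.toLp 2 fun p => if p.1 ∈ J then x p else relativeMap k A x p
  map_add' x y := by
    ext p
    by_cases hp : p.1 ∈ J <;> simp [hp]
  map_smul' c x := by
    ext p
    by_cases hp : p.1 ∈ J <;> simp [hp]

theorem mixedMap_apply_of_mem {A : Matrix (Fin n) (Fin n) ℝ} {J : Finset (Fin n)}
    (x : AgentState n k) {p : Fin n × Fin k} (hp : p.1 ∈ J) : mixedMap A J x p = x p :=
  if_pos hp

theorem mixedMap_apply_of_notMem {A : Matrix (Fin n) (Fin n) ℝ} {J : Finset (Fin n)}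
    (x : AgentState n k) {p : Fin n × Fin k} (hp : p.1 ∉ J) :
    mixedMap A J x p = relativeMap k A x p :=
  if_neg hp

namespace IsConnectedWeights

variable {A : Matrix (Fin n) (Fin n) ℝ}

/-- On the kernel each product (Ux)ₚ xₚ vanishes, so the energy is zero and x is a consensus state,
which is zero because it vanishes on `J`. -/
theorem mixedMap_injective (hA : IsConnectedWeights A) {J : Finset (Fin n)} (hJ : J.Nonempty) :
    Function.Injective (mixedMap A J : AgentState n k →ₗ[ℝ] AgentState n k) := by
  rw [injective_iff_map_eq_zero]
  intro x hx
  have hx' : ∀ p, mixedMap A J x p = 0 := fun p => by simp [hx]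
  have hin : ⟪relativeMap k A x, x⟫ = 0 := by
    rw [inner_agentState]
    refine Finset.sum_eq_zero fun p _ => ?_
    have := hx' p
    by_cases hp : p.1 ∈ J
    · rw [mixedMap_apply_of_mem x hp] at this
      simp [this]
    · rw [mixedMap_apply_of_notMem x hp] at this
      simp [this]
  obtain ⟨j, hj⟩ := hJ
  ext ⟨i, l⟩
  rw [hA.eq_of_inner_relativeMap_self_eq_zero hin i j l]
  have := hx' (j, l)
  rwa [mixedMap_apply_of_mem x (by simpa using hj)] at this

/-- The solution operator of the Dirichlet problem with boundary `J`. -/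
theorem exists_mixedMap_inverse (hA : IsConnectedWeights A) {J : Finset (Fin n)}
    (hJ : J.Nonempty) :
    ∃ R : AgentState n k →L[ℝ] AgentState n k, (∀ b, mixedMap A J (R b) = b) ∧
      ∀ x, R (mixedMap A J x) = x := by
  let e := LinearEquiv.ofInjectiveEndo _ (hA.mixedMap_injective (k := k) hJ)
  exact ⟨LinearMap.toContinuousLinearMap e.symm.toLinearMap, e.apply_symm_apply,
    e.symm_apply_apply⟩

/-- The disagreement energy is controlled by the norm of the Laplacian. -/
theorem exists_neg_inner_le_norm_sq (hA : IsConnectedWeights A) (k : ℕ) :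
    ∃ C : ℝ, 0 < C ∧ ∀ x : AgentState n k,
      -⟪relativeMap k A x, x⟫ ≤ C * ‖relativeMap k A x‖ ^ 2 := by
  classical
  rcases n.eq_zero_or_pos with rfl | hn
  · refine ⟨1, one_pos, fun x => ?_⟩
    have : x = 0 := Subsingleton.elim _ _
    simp [this]
  obtain ⟨R, hR, hR'⟩ := hA.exists_mixedMap_inverse (k := k) (J := {⟨0, hn⟩}) (by simp)
  refine ⟨‖R‖ + 1, by positivity, fun x => ?_⟩
  -- Subtracting a consensus state changes neither U x nor the energy, and makes the state zero at
  -- the grounded agent 0, where `mixedMap` then adds nothing to the norm.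
  set c := consensusState n fun l => x (⟨0, hn⟩, l)
  have hU : relativeMap k A (x - c) = relativeMap k A x := by
    rw [map_sub, relativeMap_consensusState, sub_zero]
  have h1 : ⟪relativeMap k A x, x⟫ = ⟪relativeMap k A x, x - c⟫ := by
    rw [inner_sub_right, hA.inner_relativeMap_comm x c, relativeMap_consensusState]
    simp
  have h2 : ‖mixedMap A {⟨0, hn⟩} (x - c)‖ ≤ ‖relativeMap k A x‖ := by
    rw [← sq_le_sq₀ (norm_nonneg _) (norm_nonneg _), norm_sq_agentState, norm_sq_agentState]
    refine Finset.sum_le_sum fun p _ => ?_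
    by_cases hp : p.1 ∈ ({⟨0, hn⟩} : Finset (Fin n))
    · rw [mixedMap_apply_of_mem _ hp]
      obtain ⟨i, l⟩ := p
      rw [Finset.mem_singleton] at hp
      dsimp only at hp
      subst hp
      simp only [c, consensusState, PiLp.sub_apply, sub_self]
      simpa using sq_nonneg _
    · rw [mixedMap_apply_of_notMem _ hp, hU]
  have h3 : ‖x - c‖ ≤ ‖R‖ * ‖relativeMap k A x‖ := by
    calc ‖x - c‖ = ‖R (mixedMap A {⟨0, hn⟩} (x - c))‖ := by rw [hR']
      _ ≤ ‖R‖ * ‖mixedMap A {⟨0, hn⟩} (x - c)‖ := R.le_opNorm _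
      _ ≤ _ := by gcongr
  have h4 := neg_le_of_abs_le (abs_real_inner_le_norm (relativeMap k A x) (x - c))
  rw [h1]
  nlinarith [norm_nonneg (relativeMap k A x), mul_le_mul_of_nonneg_left h3
    (norm_nonneg (relativeMap k A x)), sq_nonneg ‖relativeMap k A x‖]

/-- The norm of the Laplacian is controlled by the disagreement energy. -/
theorem exists_norm_sq_le_neg_inner (hA : IsConnectedWeights A) (k : ℕ) :
    ∃ C : ℝ, 0 < C ∧ ∀ x : AgentState n k,
      ‖relativeMap k A x‖ ^ 2 ≤ C * -⟪relativeMap k A x, x⟫ := by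
  set U := relativeMap k A
  refine ⟨‖U‖ + 1, by positivity, fun x => ?_⟩
  -- Nonnegativity of the energy at x + t U x yields the bound once t ‖U‖ ≤ 1, which lets the
  -- first-order term 2t ‖Ux‖² absorb the second-order one.
  set t : ℝ := (‖U‖ + 1)⁻¹
  have ht : 0 < t := by positivity
  have htU : t * (‖U‖ + 1) = 1 := inv_mul_cancel₀ (by positivity)
  have h := hA.inner_relativeMap_self_nonpos (x + t • U x)
  rw [map_add, map_smul, inner_add_left, inner_add_right, inner_add_right,
    real_inner_smul_left, real_inner_smul_left, real_inner_smul_right, real_inner_smul_right,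
    hA.inner_relativeMap_comm (relativeMap k A x) x, real_inner_self_eq_norm_sq] at h
  have h1 : -⟪U (U x), U x⟫ ≤ ‖U‖ * ‖U x‖ ^ 2 := by
    have h2 := neg_le_of_abs_le (abs_real_inner_le_norm (U (U x)) (U x))
    have h3 := mul_le_mul_of_nonneg_right (U.le_opNorm (U x)) (norm_nonneg (U x))
    nlinarith
  have h2 : t * (t * -⟪U (U x), U x⟫) ≤ t * (t * (‖U‖ * ‖U x‖ ^ 2)) := by gcongr
  have h3 : t * ‖U x‖ ^ 2 ≤ -⟪U x, x⟫ := by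
    have h4 : t * (t * (‖U‖ * ‖U x‖ ^ 2)) ≤ t * ‖U x‖ ^ 2 := by
      have : t * ‖U‖ ≤ 1 := by linarith
      have h5 : t * ‖U‖ * ‖U x‖ ^ 2 ≤ 1 * ‖U x‖ ^ 2 := by gcongr
      have := mul_le_mul_of_nonneg_left h5 ht.le
      linarith
    change ⟪U x, x⟫ + t * ‖U x‖ ^ 2 + (t * ‖U x‖ ^ 2 + t * (t * ⟪U (U x), U x⟫)) ≤ 0 at h
    linarith
  calc ‖U x‖ ^ 2 = (t * (‖U‖ + 1)) * ‖U x‖ ^ 2 := by rw [htU, one_mul]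
    _ = (‖U‖ + 1) * (t * ‖U x‖ ^ 2) := by ring
    _ ≤ _ := by gcongr

end IsConnectedWeights

/-- The disagreement energy `xᵀ (L ⊗ I) x / 2`. -/
def disagreement (A : Matrix (Fin n) (Fin n) ℝ) (x : AgentState n k) : ℝ :=
  -⟪relativeMap k A x, x⟫ / 2

theorem contDiff_disagreement (A : Matrix (Fin n) (Fin n) ℝ) :
    ContDiff ℝ 1 (disagreement A : AgentState n k → ℝ) := by
  unfold disagreement
  exact (((relativeMap k A).contDiff.inner ℝ contDiff_id).neg).div_const _

namespace IsConnectedWeights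

variable {A : Matrix (Fin n) (Fin n) ℝ}

theorem fderiv_disagreement (hA : IsConnectedWeights A) (x v : AgentState n k) :
    fderiv ℝ (disagreement A) x v = -∑ p, relativeMap k A x p * v p := by
  have h1 : HasFDerivAt (fun y => ⟪relativeMap k A y, y⟫) _ x :=
    (relativeMap k A).hasFDerivAt.inner ℝ (hasFDerivAt_id x)
  have h2 : HasFDerivAt (disagreement A) _ x := (h1.neg).mul_const (2⁻¹ : ℝ)
  rw [h2.fderiv]
  simp only [smul_apply, neg_apply,
    ContinuousLinearMap.comp_apply, ContinuousLinearMap.prod_apply, fderivInnerCLM_apply,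
    ContinuousLinearMap.id_apply, smul_eq_mul]
  rw [← hA.inner_relativeMap_comm x v, inner_agentState]
  ring

theorem disagreement_nonneg (hA : IsConnectedWeights A) (x : AgentState n k) :
    0 ≤ disagreement A x := by
  have := hA.inner_relativeMap_self_nonpos x
  unfold disagreement
  linarith

theorem eq_of_disagreement_eq_zero (hA : IsConnectedWeights A) {x : AgentState n k}
    (h : disagreement A x = 0) (i j : Fin n) (l : Fin k) : x (i, l) = x (j, l) :=
  hA.eq_of_inner_relativeMap_self_eq_zero (by unfold disagreement at h; linarith) i j l

theorem disagreement_consensusState (c : Fin k → ℝ) :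
    disagreement A (consensusState n c) = 0 := by
  simp [disagreement, relativeMap_consensusState]

end IsConnectedWeights

end Laplacian

/-! ### The closed-loop vector field and its Filippov map -/

section ClosedLoop

variable {n k : ℕ}

/-- The vector field `h` applies in every coordinate a scalar function to the negative Laplacian:
a locally Lipschitz, sign-preserving function for the agents in `Ic`, and the signum for the
others. -/
structure IsScalarFeedback (A : Matrix (Fin n) (Fin n) ℝ) (Ic : Finset (Fin n))
    (ψ : Fin n × Fin k → ℝ → ℝ) (h : AgentState n k → AgentState n k) : Prop where
  apply_eq : ∀ x p, h x p = ψ p (relativeMap k A x p)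
  locallyLipschitz : ∀ p, p.1 ∈ Ic → LocallyLipschitz (ψ p)
  map_zero : ∀ p, p.1 ∈ Ic → ψ p 0 = 0
  mul_self_pos : ∀ p, p.1 ∈ Ic → ∀ s, s ≠ 0 → 0 < ψ p s * s
  signum : ∀ p, p.1 ∉ Ic → ψ p = Real.sign

theorem ComponentwiseControl.exists_isScalarFeedback {Ic : Finset (Fin n)}
    {f : Fin n → (Fin k → ℝ) → (Fin k → ℝ)} (hf : ComponentwiseControl Ic f)
    (A : Matrix (Fin n) (Fin n) ℝ) : ∃ ψ, IsScalarFeedback A Ic ψ (closedLoop A f) := by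
  classical
  choose! φ hφ using hf.continuous_agents
  refine ⟨fun p => if p.1 ∈ Ic then φ p.1 p.2 else Real.sign, ?_, ?_, ?_, ?_, ?_⟩
  · intro x p
    change f p.1 (relativeState A x p.1) p.2 = _
    by_cases hp : p.1 ∈ Ic
    · rw [if_pos hp, (hφ _ hp).1]; rfl
    · rw [if_neg hp, hf.signum_agents _ hp]; rfl
  · intro p hp
    simpa [hp] using ((hφ _ hp).2 p.2).1
  · intro p hp
    simpa [hp] using ((hφ _ hp).2 p.2).2.1
  · intro p hp
    simpa [hp] using ((hφ _ hp).2 p.2).2.2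
  · intro p hp
    simp [hp]

theorem Real.continuousAt_sign {s : ℝ} (hs : s ≠ 0) : ContinuousAt Real.sign s := by
  rcases lt_or_gt_of_ne hs with h | h
  · refine (continuousAt_const (y := (-1 : ℝ))).congr ?_
    filter_upwards [Iio_mem_nhds h] with t ht using (Real.sign_of_neg ht).symm
  · refine (continuousAt_const (y := (1 : ℝ))).congr ?_
    filter_upwards [Ioi_mem_nhds h] with t ht using (Real.sign_of_pos ht).symm

theorem Real.abs_sign_le_one (s : ℝ) : |Real.sign s| ≤ 1 := by
  rcases Real.sign_apply_eq s with h | h | h <;> simp [h]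

/-- Preimages of closed convex sets under L are closed and convex; this reads off single coordinates
and conserved sums of the velocity. -/
theorem filippovMap_clm_mem {E : Type*} [NormedAddCommGroup E] [NormedSpace ℝ E] [MeasureSpace E]
    {f : E → E} {x v : E} (L : E →L[ℝ] ℝ) {I : Set ℝ} (hI : IsClosed I) (hc : Convex ℝ I)
    (h : ∀ᶠ y in 𝓝 x, L (f y) ∈ I) (hv : v ∈ filippovMap f x) : L v ∈ I :=
  filippovMap_subset_of_eventually (C := L ⁻¹' I) (hI.preimage L.continuous)
    (hc.linear_preimage L.toLinearMap) h hv

theorem filippovMap_apply_mem {f : AgentState n k → AgentState n k} {x v : AgentState n k}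
    (p : Fin n × Fin k) {I : Set ℝ} (hI : IsClosed I) (hc : Convex ℝ I)
    (h : ∀ᶠ y in 𝓝 x, f y p ∈ I) (hv : v ∈ filippovMap f x) : v p ∈ I :=
  filippovMap_clm_mem (EuclideanSpace.proj p) hI hc h hv

theorem tendsto_agentState {ι : Type*} {l : Filter ι} {y : ι → AgentState n k}
    {x : AgentState n k} (h : ∀ p, Tendsto (fun i => y i p) l (𝓝 (x p))) :
    Tendsto y l (𝓝 x) :=
  ((PiLp.continuous_toLp 2 _).tendsto (fun p => x p)).comp (tendsto_pi_nhds.2 h)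

theorem continuous_apply_agentState (p : Fin n × Fin k) :
    Continuous fun x : AgentState n k => x p :=
  (EuclideanSpace.proj (𝕜 := ℝ) p).continuous

theorem continuous_relativeMap_apply (A : Matrix (Fin n) (Fin n) ℝ) (p : Fin n × Fin k) :
    Continuous fun x : AgentState n k => relativeMap k A x p :=
  (continuous_apply_agentState p).comp (relativeMap k A).continuous

/-- There is a state in which agent `i` lies above the weighted average of its neighbours, and
every other agent lies below it by one unit. -/
theorem IsConnectedWeights.exists_relativeMap_eq_one {A : Matrix (Fin n) (Fin n) ℝ}
    (hA : IsConnectedWeights A) (i : Fin n) : ∃ d : AgentState n k,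
      ∀ p, relativeMap k A d p = if p.1 = i then 1 - (n : ℝ) else 1 := by
  classical
  obtain ⟨R, hR, -⟩ := hA.exists_mixedMap_inverse (k := k) (J := {i}) (by simp)
  set b : AgentState n k := WithLp.toLp 2 fun _ => 1
  have h1 : ∀ j l, j ≠ i → relativeMap k A (R b) (j, l) = 1 := fun j l hj => by
    rw [← mixedMap_apply_of_notMem (J := {i}) _ (by simpa using hj), hR]
  refine ⟨R b, fun ⟨j, l⟩ => ?_⟩
  by_cases hj : j = i
  · subst hj
    -- The Dirichlet problem fixes only the rows other than j; the zero sum forces row j.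
    have h2 := hA.sum_relativeMap (R b) l
    rw [← Finset.add_sum_erase _ _ (Finset.mem_univ j),
      Finset.sum_congr rfl fun i hi => h1 i l (Finset.ne_of_mem_erase hi)] at h2
    have hn : 1 ≤ n := Fin.pos j
    simp only [Finset.sum_const, Finset.card_erase_of_mem (Finset.mem_univ j), Finset.card_univ,
      Fintype.card_fin, nsmul_eq_mul, mul_one, Nat.cast_sub hn, Nat.cast_one] at h2
    simp only [if_true]
    linarith
  · simpa [hj] using h1 j l hj

namespace IsScalarFeedback

variable {A : Matrix (Fin n) (Fin n) ℝ} {Ic : Finset (Fin n)} {ψ : Fin n × Fin k → ℝ → ℝ}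
  {h : AgentState n k → AgentState n k}

theorem continuousAt (hh : IsScalarFeedback A Ic ψ h) {y : AgentState n k}
    (hy : ∀ p, p.1 ∉ Ic → relativeMap k A y p ≠ 0) : ContinuousAt h y := by
  refine tendsto_agentState fun p => ?_
  simp only [hh.apply_eq]
  have hψ : ContinuousAt (ψ p) (relativeMap k A y p) := by
    by_cases hp : p.1 ∈ Ic
    · exact (hh.locallyLipschitz p hp).continuous.continuousAt
    · rw [hh.signum p hp]
      exact Real.continuousAt_sign (hy p hp)
  exact ContinuousAt.comp (f := fun y => relativeMap k A y p) hψ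
    (continuous_relativeMap_apply A p).continuousAt

/-- A direction d for which U d has no zero entry leaves all switching hyperplanes at once; n ≥ 2
ensures 1 - n ≠ 0. -/
theorem dense_continuousAt (hh : IsScalarFeedback A Ic ψ h) (hA : IsConnectedWeights A)
    (hn : 2 ≤ n) : Dense {y | ContinuousAt h y} := by
  obtain ⟨d, hd⟩ := hA.exists_relativeMap_eq_one (k := k) ⟨0, by omega⟩
  have hd0 : ∀ p, relativeMap k A d p ≠ 0 := by
    intro p
    have : (2 : ℝ) ≤ n := by exact_mod_cast hn
    rw [hd]
    split_ifs
    · linarith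
    · exact one_ne_zero
  intro x
  have hlim : Tendsto (fun ε : ℝ => x + ε • d) (𝓝[>] 0) (𝓝 x) := by
    have : ContinuousAt (fun ε : ℝ => x + ε • d) 0 := by fun_prop
    simpa [ContinuousAt] using this.tendsto.mono_left nhdsWithin_le_nhds
  refine mem_closure_of_tendsto hlim ?_
  have hev : ∀ p, ∀ᶠ ε : ℝ in 𝓝[>] 0, relativeMap k A (x + ε • d) p ≠ 0 := by
    intro p
    by_cases hp : relativeMap k A x p = 0
    · filter_upwards [self_mem_nhdsWithin] with ε hε
      have hε' : (0 : ℝ) < ε := hε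
      simpa [hp, hε'.ne'] using hd0 p
    · exact (((continuous_relativeMap_apply A p).tendsto x).comp hlim).eventually_ne hp
  filter_upwards [eventually_all.2 hev] with ε hε
  exact hh.continuousAt fun p _ => hε p

theorem exists_bound (hh : IsScalarFeedback A Ic ψ h) (p : Fin n × Fin k) (r : ℝ) :
    ∃ B : ℝ, 0 ≤ B ∧ ∀ s, |s| ≤ r → |ψ p s| ≤ B := by
  by_cases hp : p.1 ∈ Ic
  · obtain ⟨B, hB⟩ := (isCompact_Icc (a := -r) (b := r)).exists_bound_of_continuousOn
      (hh.locallyLipschitz p hp).continuous.continuousOn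
    exact ⟨max B 0, le_max_right _ _, fun s hs =>
      (hB s (by rwa [mem_Icc, ← abs_le])).trans (le_max_left _ _)⟩
  · refine ⟨1, zero_le_one, fun s _ => ?_⟩
    rw [hh.signum p hp]
    exact Real.abs_sign_le_one s

theorem exists_uniform_bound (hh : IsScalarFeedback A Ic ψ h) (r : ℝ) :
    ∃ B : ℝ, 0 ≤ B ∧ ∀ p s, |s| ≤ r → |ψ p s| ≤ B := by
  choose B hB0 hB using fun p => hh.exists_bound p r
  refine ⟨∑ p, B p, Finset.sum_nonneg fun p _ => hB0 p, fun p s hs => (hB p s hs).trans ?_⟩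
  exact Finset.single_le_sum (f := B) (fun p _ => hB0 p) (Finset.mem_univ p)

theorem locallyBounded (hh : IsScalarFeedback A Ic ψ h) (x₀ : AgentState n k) :
    ∃ R > 0, ∃ M : ℝ≥0, ∀ y ∈ Metric.ball x₀ R, ‖h y‖ ≤ M := by
  obtain ⟨B, hB0, hB⟩ := hh.exists_uniform_bound (‖relativeMap k A‖ * (‖x₀‖ + 1))
  obtain ⟨C, hC⟩ := exists_norm_le_of_forall_abs_le n k
  refine ⟨1, one_pos, C * B.toNNReal, fun y hy => ?_⟩
  rw [NNReal.coe_mul, Real.coe_toNNReal B hB0]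
  refine hC (h y) B hB0 fun p => ?_
  rw [hh.apply_eq]
  refine hB p _ ((abs_apply_le_norm _ p).trans (((relativeMap k A).le_opNorm y).trans ?_))
  gcongr
  have h1 := norm_sub_norm_le y x₀
  rw [Metric.mem_ball, dist_eq_norm] at hy
  linarith

/-- In a coordinate where the field is continuous, the convexification collapses to a point. -/
theorem filippovMap_apply_of_mem (hh : IsScalarFeedback A Ic ψ h) {x v : AgentState n k}
    (hv : v ∈ filippovMap h x) {p : Fin n × Fin k} (hp : p.1 ∈ Ic) :
    v p = ψ p (relativeMap k A x p) := by
  refine eq_of_forall_dist_le fun ε hε => ?_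
  refine Metric.mem_closedBall.1 (filippovMap_apply_mem p Metric.isClosed_closedBall
    (convex_closedBall _ _) ?_ hv)
  simp only [hh.apply_eq]
  exact ((hh.locallyLipschitz p hp).continuous.comp
    (continuous_relativeMap_apply A p)).continuousAt.eventually (Metric.closedBall_mem_nhds _ hε)

theorem abs_filippovMap_apply_le_one (hh : IsScalarFeedback A Ic ψ h) {x v : AgentState n k}
    (hv : v ∈ filippovMap h x) {p : Fin n × Fin k} (hp : p.1 ∉ Ic) : |v p| ≤ 1 := by
  have := filippovMap_apply_mem p isClosed_Icc (convex_Icc (-1 : ℝ) 1)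
    (Eventually.of_forall fun y => ?_) hv
  · exact abs_le.2 this
  · rw [hh.apply_eq, hh.signum p hp]
    exact abs_le.1 (Real.abs_sign_le_one _)

/-- Off the switching surface the sign is locally constant; on it both sides vanish, whatever the
velocity. -/
theorem relativeMap_mul_filippovMap_apply (hh : IsScalarFeedback A Ic ψ h)
    {x v : AgentState n k} (hv : v ∈ filippovMap h x) {p : Fin n × Fin k} (hp : p.1 ∉ Ic) :
    relativeMap k A x p * v p = |relativeMap k A x p| := by
  rcases lt_trichotomy (relativeMap k A x p) 0 with hlt | heq | hgt
  · have := filippovMap_apply_mem p isClosed_singleton (convex_singleton (-1 : ℝ)) ?_ hv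
    · rw [mem_singleton_iff] at this
      rw [this, abs_of_neg hlt]; ring
    · filter_upwards [(continuous_relativeMap_apply A p).continuousAt.eventually
        (gt_mem_nhds hlt)] with y hy
      rw [hh.apply_eq, hh.signum p hp, Real.sign_of_neg hy, mem_singleton_iff]
  · simp [heq]
  · have := filippovMap_apply_mem p isClosed_singleton (convex_singleton (1 : ℝ)) ?_ hv
    · rw [mem_singleton_iff] at this
      rw [this, abs_of_pos hgt, mul_one]
    · filter_upwards [(continuous_relativeMap_apply A p).continuousAt.eventually
        (lt_mem_nhds hgt)] with y hy
      rw [hh.apply_eq, hh.signum p hp, Real.sign_of_pos hy, mem_singleton_iff]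

open Classical in
/-- The energy decreases along Filippov solutions at least at the rate given by the signum
agents. -/
theorem fderiv_disagreement_le (hh : IsScalarFeedback A Ic ψ h) (hA : IsConnectedWeights A)
    {x v : AgentState n k} (hv : v ∈ filippovMap h x) :
    fderiv ℝ (disagreement A) x v ≤
      -∑ p with p.1 ∉ Ic, |relativeMap k A x p| := by
  rw [hA.fderiv_disagreement, neg_le_neg_iff, Finset.sum_filter]
  refine Finset.sum_le_sum fun p _ => ?_
  by_cases hp : p.1 ∈ Ic
  · rw [if_neg (by simpa using hp), hh.filippovMap_apply_of_mem hv hp]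
    by_cases h0 : relativeMap k A x p = 0
    · simp [h0]
    · rw [mul_comm]
      exact (hh.mul_self_pos p hp _ h0).le
  · rw [if_pos hp, hh.relativeMap_mul_filippovMap_apply hv hp]

theorem disagreement_le (hh : IsScalarFeedback A Ic ψ h) (hA : IsConnectedWeights A)
    {T : EReal} {x : ℝ → AgentState n k} (hx : IsFilippovSolution h T x) {t : ℝ} (ht : 0 ≤ t)
    (htT : (t : EReal) < T) : disagreement A (x t) ≤ disagreement A (x 0) := by
  classical
  have := hx.sub_le_mul_of_fderiv_le (contDiff_disagreement A) (c := 0) le_rfl ht htT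
    fun s _ _ v hv => (hh.fderiv_disagreement_le hA hv).trans
      (neg_nonpos.2 (Finset.sum_nonneg fun _ _ => abs_nonneg _))
  linarith

/-- Filippov solutions are Lipschitz. -/
theorem exists_lipschitzOnWith (hh : IsScalarFeedback A Ic ψ h) (hA : IsConnectedWeights A)
    {T : EReal} {x : ℝ → AgentState n k} (hx : IsFilippovSolution h T x) :
    ∃ K : ℝ≥0, LipschitzOnWith K x {t | 0 ≤ t ∧ (t : EReal) < T} := by
  obtain ⟨C, hC0, hC⟩ := hA.exists_norm_sq_le_neg_inner k
  -- Since the energy never exceeds its initial value, this radius bounds ‖Ux‖ along the whole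
  -- solution.
  obtain ⟨B, hB0, hB⟩ := hh.exists_uniform_bound (√(C * (2 * disagreement A (x 0))))
  obtain ⟨D, hD⟩ := exists_norm_le_of_forall_abs_le n k
  set M : ℝ := max B 1
  have hM0 : 0 ≤ M := hB0.trans (le_max_left _ _)
  have hvM : ∀ t : ℝ, 0 ≤ t → (t : EReal) < T → ∀ v ∈ filippovMap h (x t), ∀ p, |v p| ≤ M := by
    intro t ht htT v hv p
    by_cases hp : p.1 ∈ Ic
    · rw [hh.filippovMap_apply_of_mem hv hp]
      refine (hB p _ ((abs_apply_le_norm _ p).trans ?_)).trans (le_max_left _ _)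
      refine Real.le_sqrt_of_sq_le ((hC _).trans ?_)
      have := hh.disagreement_le hA hx ht htT
      gcongr
      unfold disagreement at this ⊢
      linarith
    · exact (hh.abs_filippovMap_apply_le_one hv hp).trans (le_max_right _ _)
  refine ⟨D * M.toNNReal, LipschitzOnWith.of_dist_le_mul fun s hs t ht => ?_⟩
  wlog hst : s ≤ t generalizing s t
  · rw [dist_comm, dist_comm s]
    exact this t ht s hs (le_of_not_ge hst)
  rw [dist_comm, dist_comm s, dist_eq_norm, Real.dist_eq, abs_of_nonneg (by linarith)]
  refine (hD _ (M * (t - s)) (mul_nonneg hM0 (by linarith)) fun p => ?_).trans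
    (by rw [NNReal.coe_mul, Real.coe_toNNReal M hM0, mul_assoc])
  have hle : ∀ L : AgentState n k →L[ℝ] ℝ, (∀ v, L v = v p ∨ L v = -v p) →
      L (x t) - L (x s) ≤ M * (t - s) := by
    intro L hL
    refine hx.sub_le_mul_of_fderiv_le L.contDiff hs.1 hst ht.2 fun r hsr hrt v hv => ?_
    rw [L.fderiv]
    have h1 := hvM r (hs.1.trans hsr.le) (lt_trans (by exact_mod_cast hrt) ht.2) v hv p
    have h2 := abs_le.1 h1
    rcases hL v with h | h <;> rw [h] <;> linarith
  rw [PiLp.sub_apply, abs_le]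
  have h1 := hle (EuclideanSpace.proj p) fun v => Or.inl rfl
  have h2 := hle (-EuclideanSpace.proj p) fun v => Or.inr rfl
  change x t p - x s p ≤ _ at h1
  change -x t p - -x s p ≤ _ at h2
  constructor <;> linarith

theorem eq_top (hh : IsScalarFeedback A Ic ψ h) (hA : IsConnectedWeights A) (hn : 2 ≤ n)
    {T : EReal} {x : ℝ → AgentState n k} (hx : IsMaximalFilippovSolution h T x) : T = ⊤ := by
  obtain ⟨K, hK⟩ := hh.exists_lipschitzOnWith hA hx.isSolution
  exact hx.eq_top (hh.dense_continuousAt hA hn) hh.locallyBounded hK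

end IsScalarFeedback

end ClosedLoop

/-! ### Convergence in finite time -/

/-- A nonnegative function which satisfies `W' ≤ -c √W` in integrated form vanishes after a finite
time. -/
theorem exists_forall_ge_eq_zero_of_sub_le_sqrt {W : ℝ → ℝ} {c : ℝ} (hc : 0 < c)
    (hW : ∀ t, 0 ≤ t → 0 ≤ W t)
    (h : ∀ a b m : ℝ, 0 ≤ a → a ≤ b → 0 ≤ m → (∀ t, a < t → t < b → m ≤ W t) →
      W b - W a ≤ -(c * √m) * (b - a)) :
    ∃ t₀ : ℝ, 0 < t₀ ∧ ∀ t, t₀ ≤ t → W t = 0 := by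
  have hanti : ∀ a b : ℝ, 0 ≤ a → a ≤ b → W b ≤ W a := by
    intro a b ha hab
    have := h a b 0 ha hab le_rfl fun t hat _ => hW t (ha.trans hat.le)
    simp at this
    linarith
  set r : ℝ := √(W 0) + 1
  have hr : 0 < r := by positivity
  have hr2 : W 0 ≤ r ^ 2 := by
    have := Real.sq_sqrt (hW 0 le_rfl)
    nlinarith [Real.sqrt_nonneg (W 0)]
  -- With q = 2⁻ᵐ, halving the bound r q on √W takes time at most 2 r q / c: otherwise W would lose
  -- (r q)² or more and be nonpositive. These times add up to 4 r / c.
  have hstep : ∀ m : ℕ, W (4 * r / c * (1 - (1 / 2) ^ m)) ≤ (r * (1 / 2) ^ m) ^ 2 := by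
    intro m
    induction m with
    | zero => simpa using hr2
    | succ m ih =>
      set q : ℝ := (1 / 2) ^ m
      have hq : 0 < q := by positivity
      have hq1 : q ≤ 1 := pow_le_one₀ (by norm_num) (by norm_num)
      have hqs : ((1 : ℝ) / 2) ^ (m + 1) = q / 2 := by rw [pow_succ]; ring
      rw [hqs]
      set a := 4 * r / c * (1 - q)
      have ha : 0 ≤ a := mul_nonneg (by positivity) (by linarith)
      have hb : 4 * r / c * (1 - q / 2) = a + 2 * r * q / c := by
        simp only [a]; field_simp; ring
      rw [hb]
      have hd : 0 < 2 * r * q / c := by positivity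
      by_contra! hlt
      have h1 := h a (a + 2 * r * q / c) ((r * (q / 2)) ^ 2) ha (by linarith) (by positivity)
        fun t hat htb => hlt.le.trans (hanti _ _ (ha.trans hat.le) htb.le)
      rw [Real.sqrt_sq (by positivity)] at h1
      have h2 : -(c * (r * (q / 2))) * (a + 2 * r * q / c - a) = -(r * q) ^ 2 := by
        field_simp; ring
      rw [h2] at h1
      have h3 : 0 < (r * (q / 2)) ^ 2 := by positivity
      linarith
  have ht0 : 0 < 4 * r / c := by positivity
  refine ⟨4 * r / c, ht0, fun t ht => le_antisymm ?_ (hW t (ht0.le.trans ht))⟩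
  have hlim : Tendsto (fun m : ℕ => (r * (1 / 2 : ℝ) ^ m) ^ 2) atTop (𝓝 ((r * 0) ^ 2)) :=
    ((tendsto_pow_atTop_nhds_zero_of_lt_one (by norm_num) (by norm_num)).const_mul r).pow 2
  rw [mul_zero, zero_pow two_ne_zero] at hlim
  refine ge_of_tendsto' hlim fun m => (hanti _ _ ?_ ?_).trans (hstep m)
  · have : ((1 : ℝ) / 2) ^ m ≤ 1 := pow_le_one₀ (by norm_num) (by norm_num)
    exact mul_nonneg ht0.le (by linarith)
  · have : (0 : ℝ) < (1 / 2) ^ m := by positivity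
    nlinarith

namespace IsScalarFeedback

variable {n k : ℕ} {A : Matrix (Fin n) (Fin n) ℝ} {Ic : Finset (Fin n)}
  {ψ : Fin n × Fin k → ℝ → ℝ} {h : AgentState n k → AgentState n k}

-- The entry of the only continuous agent is minus the sum of the other agents' entries in the same
-- component, and those are all signum agents.
open Classical in
theorem abs_relativeMap_le_sum (hA : IsConnectedWeights A) (hIc : Ic.card ≤ 1)
    (x : AgentState n k) (p : Fin n × Fin k) :
    |relativeMap k A x p| ≤ ∑ q : Fin n × Fin k with q.1 ∉ Ic, |relativeMap k A x q| := by
  by_cases hp : p.1 ∈ Ic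
  · obtain ⟨i, l⟩ := p
    have h0 := hA.sum_relativeMap x l
    rw [← Finset.add_sum_erase _ _ (Finset.mem_univ i)] at h0
    rw [eq_neg_of_add_eq_zero_left h0, abs_neg]
    refine (Finset.abs_sum_le_sum_abs _ _).trans ?_
    rw [← Finset.sum_image (s := Finset.univ.erase i) (g := fun j => (j, l))
      (f := fun q => |relativeMap k A x q|) (by intro a _ b _ hab; simpa using hab)]
    refine Finset.sum_le_sum_of_subset_of_nonneg (fun q hq => ?_) fun _ _ _ => abs_nonneg _
    simp only [Finset.mem_image, Finset.mem_erase, Finset.mem_univ, and_true] at hq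
    obtain ⟨j, hj, rfl⟩ := hq
    simp only [Finset.mem_filter, Finset.mem_univ, true_and]
    exact fun hjc => hj (Finset.card_le_one.1 hIc j hjc i hp)
  · exact Finset.single_le_sum (f := fun q => |relativeMap k A x q|) (fun _ _ => abs_nonneg _)
      (by simpa using hp)

theorem exists_disagreement_eq_zero (hh : IsScalarFeedback A Ic ψ h) (hA : IsConnectedWeights A)
    (hIc : Ic.card ≤ 1) {x : ℝ → AgentState n k} (hx : IsFilippovSolution h ⊤ x) :
    ∃ t₀ : ℝ, 0 < t₀ ∧ ∀ t, t₀ ≤ t → disagreement A (x t) = 0 := by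
  classical
  obtain ⟨C, hC0, hC⟩ := hA.exists_neg_inner_le_norm_sq k
  obtain ⟨D, hD⟩ := exists_norm_le_of_forall_abs_le n k
  have hDn : (0 : ℝ) ≤ D := D.2
  have hbound : ∀ y : AgentState n k, √(disagreement A y) ≤
      √C * (D + 1) * ∑ p : Fin n × Fin k with p.1 ∉ Ic, |relativeMap k A y p| := by
    intro y
    set S := ∑ p : Fin n × Fin k with p.1 ∉ Ic, |relativeMap k A y p|
    have hS : 0 ≤ S := Finset.sum_nonneg fun _ _ => abs_nonneg _
    have h1 : ‖relativeMap k A y‖ ≤ (D + 1) * S := by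
      have := hD (relativeMap k A y) S hS fun p => abs_relativeMap_le_sum hA hIc y p
      linarith
    rw [mul_assoc]
    calc √(disagreement A y) ≤ √(C * ‖relativeMap k A y‖ ^ 2) := by
          refine Real.sqrt_le_sqrt ?_
          have h2 := hC y
          have h3 := hA.inner_relativeMap_self_nonpos y
          unfold disagreement
          linarith
      _ = √C * ‖relativeMap k A y‖ := by
          rw [Real.sqrt_mul hC0.le, Real.sqrt_sq (norm_nonneg _)]
      _ ≤ _ := by gcongr
  have hK : 0 < √C * (D + 1) := by positivity
  refine exists_forall_ge_eq_zero_of_sub_le_sqrt (W := fun t => disagreement A (x t))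
    (inv_pos.2 hK) (fun t _ => hA.disagreement_nonneg _) fun a b m ha hab _ hm => ?_
  refine hx.sub_le_mul_of_fderiv_le (contDiff_disagreement A) ha hab (EReal.coe_lt_top b)
    fun t hat htb v hv => (hh.fderiv_disagreement_le hA hv).trans (neg_le_neg ?_)
  rw [inv_mul_le_iff₀ hK]
  exact (Real.sqrt_le_sqrt (hm t hat htb)).trans (hbound _)

/-- A linear functional which vanishes on the Filippov map along a solution from time `t₀` on is
constant along that solution from time `t₀` on. -/
theorem clm_eq_of_forall_mem {x : ℝ → AgentState n k} (hx : IsFilippovSolution h ⊤ x)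
    (L : AgentState n k →L[ℝ] ℝ) {t₀ : ℝ} (ht₀ : 0 ≤ t₀)
    (hL : ∀ t, t₀ ≤ t → ∀ v ∈ filippovMap h (x t), L v = 0) {t : ℝ} (ht : t₀ ≤ t) :
    L (x t) = L (x t₀) := by
  have key : ∀ L : AgentState n k →L[ℝ] ℝ,
      (∀ t, t₀ ≤ t → ∀ v ∈ filippovMap h (x t), L v = 0) → L (x t) - L (x t₀) ≤ 0 := by
    intro L hL
    have := hx.sub_le_mul_of_fderiv_le L.contDiff (c := 0) ht₀ ht (EReal.coe_lt_top t)
      fun s hs _ v hv => by rw [L.fderiv, hL s hs.le v hv]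
    linarith
  have h1 := key L hL
  have h2 := key (-L) fun s hs v hv => by simp [hL s hs v hv]
  simp only [neg_apply] at h2
  linarith

/-- The continuous agent is the anchor: once the energy is zero it is at rest, and the other agents
coincide with it. -/
theorem finiteTimeConsensus_of_card_eq_one (hh : IsScalarFeedback A Ic ψ h)
    (hA : IsConnectedWeights A) (hn : 2 ≤ n) (hIc : Ic.card = 1) : FiniteTimeConsensus h := by
  intro T x hx
  obtain rfl : T = ⊤ := hh.eq_top hA hn hx
  obtain ⟨t₀, ht₀, hV⟩ := hh.exists_disagreement_eq_zero hA hIc.le hx.isSolution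
  obtain ⟨i, rfl⟩ := Finset.card_eq_one.1 hIc
  refine ⟨rfl, t₀, ht₀, fun l => x t₀ (i, l), fun t ht => ?_⟩
  ext ⟨j, l⟩
  rw [hA.eq_of_disagreement_eq_zero (hV t ht) j i l]
  refine clm_eq_of_forall_mem hx.isSolution (EuclideanSpace.proj (i, l)) ht₀.le
    (fun s hs v hv => ?_) ht
  have hi : ((i, l) : Fin n × Fin k).1 ∈ ({i} : Finset (Fin n)) := by simp
  change v (i, l) = 0
  rw [hh.filippovMap_apply_of_mem hv hi]
  have : relativeMap k A (x s) (i, l) = 0 := by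
    rw [relativeMap_apply]
    refine Finset.sum_eq_zero fun j _ => ?_
    rw [hA.eq_of_disagreement_eq_zero (hV s hs) j i l, sub_self, mul_zero]
  rw [this, hh.map_zero _ hi]

/-- The two relative states are opposite and the signum is odd, so x₀ + x₁ is conserved and fixes
the consensus value. -/
theorem finiteTimeConsensus_of_two_of_card_eq_zero {A : Matrix (Fin 2) (Fin 2) ℝ}
    {Ic : Finset (Fin 2)} {ψ : Fin 2 × Fin k → ℝ → ℝ} {h : AgentState 2 k → AgentState 2 k}
    (hh : IsScalarFeedback A Ic ψ h) (hA : IsConnectedWeights A) (hIc : Ic = ∅) :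
    FiniteTimeConsensus h := by
  intro T x hx
  obtain rfl : T = ⊤ := hh.eq_top hA le_rfl hx
  obtain ⟨t₀, ht₀, hV⟩ := hh.exists_disagreement_eq_zero hA (by simp [hIc]) hx.isSolution
  refine ⟨rfl, t₀, ht₀, fun l => x t₀ (0, l), fun t ht => ?_⟩
  ext ⟨j, l⟩
  rw [hA.eq_of_disagreement_eq_zero (hV t ht) j 0 l]
  have hsum := clm_eq_of_forall_mem hx.isSolution
    (EuclideanSpace.proj ((0, l) : Fin 2 × Fin k) + EuclideanSpace.proj (1, l)) ht₀.le
    (fun s hs v hv => ?_) ht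
  · have h1 := hA.eq_of_disagreement_eq_zero (hV t ht) 1 0 l
    have h2 := hA.eq_of_disagreement_eq_zero (hV t₀ le_rfl) 1 0 l
    change x t (0, l) + x t (1, l) = x t₀ (0, l) + x t₀ (1, l) at hsum
    change x t (0, l) = x t₀ (0, l)
    linarith
  · refine filippovMap_clm_mem _ isClosed_singleton (convex_singleton (0 : ℝ))
      (Eventually.of_forall fun y => ?_) hv
    change h y (0, l) + h y (1, l) = 0
    have h0 := hA.sum_relativeMap y l
    rw [Fin.sum_univ_two] at h0
    rw [hh.apply_eq, hh.apply_eq, hh.signum _ (by simp [hIc]), hh.signum _ (by simp [hIc]),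
      eq_neg_of_add_eq_zero_left h0, Real.sign_neg, neg_add_cancel]

end IsScalarFeedback

/-! ### Solutions which do not reach static consensus in finite time -/

theorem le_of_hasDerivAt_nonpos_of_pos {g g' : ℝ → ℝ} (hc : Continuous g)
    (hg : ∀ t, 0 < t → HasDerivAt g (g' t) t) (hg' : ∀ t, 0 < t → g' t ≤ 0) {t : ℝ}
    (ht : 0 ≤ t) : g t ≤ g 0 := by
  refine antitoneOn_of_deriv_nonpos (convex_Ici 0) hc.continuousOn ?_ ?_ self_mem_Ici ht ht
  · rw [interior_Ici]
    exact fun s hs => (hg s hs).differentiableAt.differentiableWithinAt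
  · rw [interior_Ici]
    exact fun s hs => (hg s hs).deriv ▸ hg' s hs

/-- Rescaling of the real line onto `[-η, η]` which fixes `[-η, η]`. -/
def radialClamp (η s : ℝ) : ℝ := η / max η |s| * s

theorem continuous_radialClamp {η : ℝ} (hη : 0 < η) : Continuous (radialClamp η) := by
  unfold radialClamp
  exact (continuous_const.div (by fun_prop) fun s => (lt_max_of_lt_left hη).ne').mul continuous_id

theorem abs_radialClamp_le {η : ℝ} (hη : 0 < η) (s : ℝ) : |radialClamp η s| ≤ η := by
  have hm : 0 < max η |s| := lt_max_of_lt_left hη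
  rw [radialClamp, abs_mul, abs_div, abs_of_pos hη, abs_of_pos hm, div_mul_eq_mul_div,
    div_le_iff₀ hm]
  exact mul_le_mul_of_nonneg_left (le_max_right _ _) hη.le

theorem radialClamp_of_abs_le {η s : ℝ} (hη : 0 < η) (hs : |s| ≤ η) : radialClamp η s = s := by
  rw [radialClamp, max_eq_left hs, div_self hη.ne', one_mul]

namespace IsScalarFeedback

variable {n k : ℕ} {A : Matrix (Fin n) (Fin n) ℝ} {Ic : Finset (Fin n)}
  {ψ : Fin n × Fin k → ℝ → ℝ} {h : AgentState n k → AgentState n k}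

/-- Leaving the consensus state in a direction from `exists_relativeMap_eq_one` shows the signs -1
for agent i and +1 for the rest. The mean over i is (n - 1 - 1)/n in every coordinate. -/
theorem consensusState_mem_filippovMap (hh : IsScalarFeedback A Ic ψ h)
    (hA : IsConnectedWeights A) (hIc : Ic = ∅) (hn : 2 ≤ n) (c : Fin k → ℝ) :
    consensusState n (fun _ : Fin k => ((n : ℝ) - 2) / n) ∈
      filippovMap h (consensusState n c) := by
  have hn' : (2 : ℝ) ≤ n := by exact_mod_cast hn
  have hmem : ∀ i : Fin n, (WithLp.toLp 2 fun p => if p.1 = i then (-1 : ℝ) else 1) ∈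
      filippovMap h (consensusState n c) := by
    intro i
    obtain ⟨d, hd⟩ := hA.exists_relativeMap_eq_one (k := k) i
    have hU : ∀ (ε : ℝ) p, relativeMap k A (consensusState n c + ε • d) p =
        ε * if p.1 = i then 1 - (n : ℝ) else 1 := fun ε p => by
      rw [map_add, relativeMap_consensusState, zero_add, map_smul, PiLp.smul_apply, hd,
        smul_eq_mul]
    refine mem_filippovMap_of_tendsto (l := 𝓝[>] (0 : ℝ))
      (y := fun ε => consensusState n c + ε • d) ?_ ?_ ?_
    · have : ContinuousAt (fun ε : ℝ => consensusState n c + ε • d) 0 := by fun_prop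
      simpa [ContinuousAt] using this.tendsto.mono_left nhdsWithin_le_nhds
    · filter_upwards [self_mem_nhdsWithin] with ε hε
      have hε' : (0 : ℝ) < ε := hε
      refine hh.continuousAt fun p _ => ?_
      rw [hU]
      refine mul_ne_zero hε'.ne' ?_
      split_ifs
      · linarith
      · exact one_ne_zero
    · refine tendsto_const_nhds.congr' ?_
      filter_upwards [self_mem_nhdsWithin] with ε hε
      have hε' : (0 : ℝ) < ε := hε
      ext p
      rw [hh.apply_eq, hU, hh.signum p (by simp [hIc])]
      by_cases hp : p.1 = i
      · simp only [hp, if_true]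
        rw [Real.sign_of_neg (mul_neg_of_pos_of_neg hε' (by linarith))]
      · simp only [hp, if_false]
        rw [Real.sign_of_pos (by linarith)]
  have h0 : (0 : ℝ) < n := by linarith
  have hsum := (convex_filippovMap h (consensusState n c)).sum_mem (t := Finset.univ)
    (w := fun _ : Fin n => (n : ℝ)⁻¹) (fun _ _ => by positivity)
    (by simp [h0.ne']) fun i _ => hmem i
  convert hsum using 1
  ext p
  have h1 : ∑ i : Fin n, (if p.1 = i then (-1 : ℝ) else 1) = n - 2 := by
    have h2 : ∀ i : Fin n, (if p.1 = i then (-1 : ℝ) else 1) =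
        1 - if p.1 = i then (2 : ℝ) else 0 := fun i => by split_ifs <;> norm_num
    simp [h2, Finset.sum_sub_distrib]
  have h3 : (∑ i : Fin n, (n : ℝ)⁻¹ • (WithLp.toLp 2 fun p : Fin n × Fin k =>
      if p.1 = i then (-1 : ℝ) else 1) : AgentState n k) p =
      ∑ i : Fin n, (n : ℝ)⁻¹ * (if p.1 = i then (-1 : ℝ) else 1) := by
    simp
  rw [h3, ← Finset.mul_sum, h1]
  simp [consensusState, div_eq_inv_mul]

/-- If all agents use the signum and there are more than two of them, the consensus value can
drift. -/
theorem not_finiteTimeConsensus_of_card_eq_zero (hh : IsScalarFeedback A Ic ψ h)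
    (hA : IsConnectedWeights A) (hIc : Ic = ∅) (hn : 2 < n) (hk : 0 < k) :
    ¬ FiniteTimeConsensus h := by
  intro hcons
  have hn' : (2 : ℝ) < n := by exact_mod_cast hn
  set e : AgentState n k := consensusState n fun _ => ((n : ℝ) - 2) / n
  have hlin : ∀ t : ℝ, t • e = consensusState n fun _ => t * (((n : ℝ) - 2) / n) := fun t => by
    ext p; simp [e, consensusState]
  have hmax : IsMaximalFilippovSolution h ⊤ fun t : ℝ => t • e := by
    refine IsMaximalFilippovSolution.of_hasDerivAt (K := ‖e‖₊) ?_ fun t _ => ⟨e, ?_, ?_⟩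
    · refine LipschitzWith.of_dist_le_mul fun s t => ?_
      rw [dist_eq_norm, ← sub_smul, norm_smul, Real.dist_eq, coe_nnnorm, Real.norm_eq_abs,
        mul_comm]
    · simp only [hlin]
      exact hh.consensusState_mem_filippovMap hA hIc hn.le _
    · simpa using (hasDerivAt_id t).smul_const e
  obtain ⟨-, t₀, ht₀, c, hc⟩ := hcons ⊤ _ hmax
  have h1 : t₀ • e = (t₀ + 1) • e := (hc t₀ le_rfl).trans (hc (t₀ + 1) (by linarith)).symm
  have h2 := congrArg (fun y : AgentState n k => y (⟨0, by omega⟩, ⟨0, hk⟩)) h1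
  have h3 : 0 < ((n : ℝ) - 2) / n := div_pos (by linarith) (by linarith)
  simp only [hlin, consensusState] at h2
  linarith

/-- Sliding velocities: where the signum agents see no disagreement, they can move with any
velocity whose components are bounded by one. -/
theorem mem_filippovMap_of_sliding (hh : IsScalarFeedback A Ic ψ h) (hA : IsConnectedWeights A)
    (hIc : Ic.Nonempty) {x v : AgentState n k}
    (hx : ∀ p, p.1 ∉ Ic → relativeMap k A x p = 0)
    (hv : ∀ p, p.1 ∈ Ic → v p = ψ p (relativeMap k A x p)) (hv' : ∀ p, p.1 ∉ Ic → |v p| ≤ 1) :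
    v ∈ filippovMap h x := by
  classical
  obtain ⟨R, hR, -⟩ := hA.exists_mixedMap_inverse (k := k) hIc
  set t : Fin n × Fin k → Set ℝ := fun p =>
    if p.1 ∈ Ic then {ψ p (relativeMap k A x p)} else {-1, 1}
  set C : Set (Fin n × Fin k → ℝ) := {u | WithLp.toLp 2 u ∈ filippovMap h x}
  have hC : Convex ℝ C := (convex_filippovMap h x).linear_preimage
    (WithLp.linearEquiv 2 ℝ (Fin n × Fin k → ℝ)).symm.toLinearMap
  -- It suffices to reach the vertices of the box of velocities: a sign pattern u appears on moving
  -- along d with (Ud)ₚ = uₚ at the signum agents, found by a Dirichlet problem.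
  have ht : univ.pi t ⊆ C := by
    intro u hu
    have hu1 : ∀ p, p.1 ∈ Ic → u p = ψ p (relativeMap k A x p) := fun p hp => by
      simpa [t, hp] using hu p (mem_univ p)
    have hu2 : ∀ p, p.1 ∉ Ic → u p = -1 ∨ u p = 1 := fun p hp => by
      simpa [t, hp] using hu p (mem_univ p)
    set d : AgentState n k := R (WithLp.toLp 2 fun p => if p.1 ∈ Ic then 0 else u p)
    have hd : ∀ p, p.1 ∉ Ic → relativeMap k A d p = u p := fun p hp => by
      rw [← mixedMap_apply_of_notMem d hp, hR]
      simp [hp]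
    have hU : ∀ (ε : ℝ) p, p.1 ∉ Ic → relativeMap k A (x + ε • d) p = ε * u p := fun ε p hp => by
      rw [map_add, map_smul, PiLp.add_apply, PiLp.smul_apply, hx p hp, hd p hp, zero_add,
        smul_eq_mul]
    have hlim : Tendsto (fun ε : ℝ => x + ε • d) (𝓝[>] 0) (𝓝 x) := by
      have : ContinuousAt (fun ε : ℝ => x + ε • d) 0 := by fun_prop
      simpa [ContinuousAt] using this.tendsto.mono_left nhdsWithin_le_nhds
    refine mem_filippovMap_of_tendsto hlim ?_ (tendsto_agentState fun p => ?_)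
    · filter_upwards [self_mem_nhdsWithin] with ε hε
      have hε' : (0 : ℝ) < ε := hε
      refine hh.continuousAt fun p hp => ?_
      rw [hU ε p hp]
      rcases hu2 p hp with h | h <;> simp [h, hε'.ne']
    · simp only [hh.apply_eq]
      by_cases hp : p.1 ∈ Ic
      · rw [hu1 p hp]
        exact (((hh.locallyLipschitz p hp).continuous.comp
          (continuous_relativeMap_apply A p)).tendsto x).comp hlim
      · refine tendsto_const_nhds.congr' ?_
        filter_upwards [self_mem_nhdsWithin] with ε hε
        have hε' : (0 : ℝ) < ε := hε
        rw [hh.signum p hp, hU ε p hp]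
        rcases hu2 p hp with h | h
        · rw [h, Real.sign_of_neg (by linarith)]
        · rw [h, Real.sign_of_pos (by linarith)]
  have hsub := convexHull_min ht hC
  rw [convexHull_pi] at hsub
  refine hsub (a := fun p => v p) fun p _ => ?_
  by_cases hp : p.1 ∈ Ic
  · simp [t, hp, hv p hp]
  · have := abs_le.1 (hv' p hp)
    simp only [t, if_neg hp]
    rw [convexHull_pair, segment_eq_Icc (by norm_num)]
    exact this

/-- The only use of the Lipschitz condition beyond continuity: a linear bound near 0 is what rules
out finite-time decay. -/
theorem exists_abs_le_mul_abs (hh : IsScalarFeedback A Ic ψ h) :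
    ∃ K η : ℝ, 0 ≤ K ∧ 0 < η ∧
      ∀ p, p.1 ∈ Ic → ∀ s, |s| ≤ η → |ψ p s| ≤ K * |s| := by
  have hp : ∀ p, ∃ K : ℝ, 0 ≤ K ∧ (p.1 ∈ Ic → ∀ᶠ s in 𝓝 (0 : ℝ), |ψ p s| ≤ K * |s|) := by
    intro p
    by_cases hp : p.1 ∈ Ic
    · obtain ⟨K, t, ht, hK⟩ := hh.locallyLipschitz p hp 0
      refine ⟨K, K.2, fun _ => ?_⟩
      filter_upwards [ht] with s hs
      simpa [hh.map_zero p hp] using hK.dist_le_mul s hs 0 (mem_of_mem_nhds ht)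
    · exact ⟨0, le_rfl, fun h => absurd h hp⟩
  choose K hK0 hK using hp
  have hall : ∀ᶠ s in 𝓝 (0 : ℝ), ∀ p, p.1 ∈ Ic → |ψ p s| ≤ K p * |s| := by
    refine eventually_all.2 fun p => ?_
    by_cases hp : p.1 ∈ Ic
    · filter_upwards [hK p hp] with s hs _ using hs
    · exact Eventually.of_forall fun s h => absurd h hp
  obtain ⟨η, hη, hball⟩ := Metric.eventually_nhds_iff.1 hall
  refine ⟨∑ p, K p, η / 2, Finset.sum_nonneg fun p _ => hK0 p, half_pos hη,
    fun p hp s hs => ?_⟩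
  refine (hball (by rw [Real.dist_0_eq_abs]; linarith) p hp).trans ?_
  gcongr
  exact Finset.single_le_sum (f := K) (fun p _ => hK0 p) (Finset.mem_univ p)

/-- With two or more continuous agents there is a sliding solution whose disagreement decays at
most exponentially. -/
theorem not_finiteTimeConsensus_of_one_lt_card (hh : IsScalarFeedback A Ic ψ h)
    (hA : IsConnectedWeights A) (hIc : 1 < Ic.card) (hk : 0 < k) :
    ¬ FiniteTimeConsensus h := by
  classical
  intro hcons
  obtain ⟨i, hi, j, hj, hij⟩ := Finset.one_lt_card.1 hIc
  obtain ⟨R, hR, -⟩ := hA.exists_mixedMap_inverse (k := k) ⟨i, hi⟩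
  obtain ⟨C, hC0, hC⟩ := hA.exists_norm_sq_le_neg_inner k
  obtain ⟨D, hD⟩ := exists_norm_le_of_forall_abs_le n k
  obtain ⟨K, η₀, hK0, hη₀, hK⟩ := hh.exists_abs_le_mul_abs
  have hDn : (0 : ℝ) ≤ D := D.2
  -- Boundary data bounded by r give Dirichlet solutions of norm at most 1, an admissible speed for
  -- signum agents.
  set r : ℝ := (‖R‖ * D + 1)⁻¹
  have hr : 0 < r := by positivity
  set η : ℝ := min η₀ (r / (K + 1))
  have hη : 0 < η := lt_min hη₀ (by positivity)
  set b : AgentState n k → AgentState n k := fun y => WithLp.toLp 2 fun p =>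
    if p.1 ∈ Ic then ψ p (radialClamp η (relativeMap k A y p)) else 0
  have hb1 : ∀ y p, p.1 ∈ Ic → b y p = ψ p (radialClamp η (relativeMap k A y p)) :=
    fun y p hp => if_pos hp
  have hb2 : ∀ y p, p.1 ∉ Ic → b y p = 0 := fun y p hp => if_neg hp
  have hbr : ∀ y p, |b y p| ≤ r := by
    intro y p
    by_cases hp : p.1 ∈ Ic
    · rw [hb1 y p hp]
      have h1 := abs_radialClamp_le hη (relativeMap k A y p)
      refine (hK p hp _ (h1.trans (min_le_left _ _))).trans ?_
      have h2 := h1.trans (min_le_right _ _)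
      rw [le_div_iff₀ (by positivity)] at h2
      nlinarith [abs_nonneg (radialClamp η (relativeMap k A y p))]
    · rw [hb2 y p hp, abs_zero]
      exact hr.le
  have hbcont : Continuous b := by
    refine (PiLp.continuous_toLp 2 _).comp (continuous_pi fun p => ?_)
    by_cases hp : p.1 ∈ Ic
    · simp only [hp, if_true]
      exact (hh.locallyLipschitz p hp).continuous.comp
        ((continuous_radialClamp hη).comp (continuous_relativeMap_apply A p))
    · simp only [hp, if_false]
      exact continuous_const
  -- The sliding field: continuous agents follow their clamped control, and the others move so that
  -- U g vanishes at them. Clamping makes g globally bounded, as the existence theorem requires.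
  set g : AgentState n k → AgentState n k := fun y => R (b y)
  have hg1 : ∀ y p, p.1 ∈ Ic → g y p = ψ p (radialClamp η (relativeMap k A y p)) :=
    fun y p hp => by rw [← mixedMap_apply_of_mem (A := A) (g y) hp, hR, hb1 y p hp]
  have hg2 : ∀ y p, p.1 ∉ Ic → relativeMap k A (g y) p = 0 :=
    fun y p hp => by rw [← mixedMap_apply_of_notMem (g y) hp, hR, hb2 y p hp]
  have hgM : ∀ y, ‖g y‖ ≤ ((1 : ℝ≥0) : ℝ) := by
    intro y
    refine (R.le_opNorm _).trans ?_
    have h1 : ‖R‖ * ‖b y‖ ≤ ‖R‖ * (D * r) :=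
      mul_le_mul_of_nonneg_left (hD _ _ hr.le (hbr y)) (norm_nonneg _)
    have h2 : (‖R‖ * D + 1) * r = 1 := mul_inv_cancel₀ (by positivity)
    rw [NNReal.coe_one]
    nlinarith
  -- The initial direction lies on the sliding surface and separates the continuous agents i and j,
  -- so its energy is positive.
  set z : AgentState n k := R (WithLp.toLp 2 fun p => if p.1 = i then 1 else 0)
  have hz1 : ∀ p, p.1 ∈ Ic → z p = if p.1 = i then 1 else 0 := fun p hp => by
    rw [← mixedMap_apply_of_mem (A := A) z hp, hR]
  have hz2 : ∀ p, p.1 ∉ Ic → relativeMap k A z p = 0 := fun p hp => by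
    rw [← mixedMap_apply_of_notMem z hp, hR]
    exact if_neg fun h : p.1 = i => hp (h ▸ hi)
  have hVz : 0 < disagreement A z := by
    refine lt_of_le_of_ne (hA.disagreement_nonneg z) fun h0 => ?_
    have := hA.eq_of_disagreement_eq_zero h0.symm i j ⟨0, hk⟩
    rw [hz1 _ hi, hz1 _ hj] at this
    simp [hij.symm] at this
  have hVs : ∀ s : ℝ, disagreement A (s • z) = s ^ 2 * disagreement A z := fun s => by
    unfold disagreement
    rw [map_smul, real_inner_smul_left, real_inner_smul_right]
    ring
  obtain ⟨s, hs, hsη⟩ : ∃ s : ℝ, 0 < s ∧ 2 * C * disagreement A (s • z) ≤ η ^ 2 := by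
    refine ⟨η / √(2 * C * disagreement A z), by positivity, ?_⟩
    rw [hVs, div_pow, Real.sq_sqrt (by positivity)]
    exact le_of_eq (by field_simp)
  obtain ⟨x, hx0, hxL, hx⟩ :=
    exists_hasDerivAt_of_continuous_of_bounded (g := g) (R.continuous.comp hbcont) hgM (s • z)
  have hxc : Continuous x := hxL.continuous
  have hslide : ∀ t, 0 ≤ t → ∀ p, p.1 ∉ Ic → relativeMap k A (x t) p = 0 := by
    intro t ht p hp
    set L : AgentState n k →L[ℝ] ℝ := (EuclideanSpace.proj p).comp (relativeMap k A)
    have hL : ∀ t, 0 < t → HasDerivAt (fun t => L (x t)) 0 t := fun t ht => by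
      have := L.hasFDerivAt.comp_hasDerivAt t (hx t ht)
      change HasDerivAt (fun t => L (x t)) (L (g (x t))) t at this
      rwa [show L (g (x t)) = 0 from hg2 _ p hp] at this
    have h0 : L (x 0) = 0 := by
      rw [hx0, map_smul, show L z = 0 from hz2 p hp, smul_zero]
    have h1 := le_of_hasDerivAt_nonpos_of_pos (L.continuous.comp hxc) hL (fun _ _ => le_rfl) ht
    have h2 := le_of_hasDerivAt_nonpos_of_pos (L.continuous.comp hxc).neg
      (fun t ht => (hL t ht).neg) (fun _ _ => by simp) ht
    simp only [Function.comp_apply, Pi.neg_apply, h0] at h1 h2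
    change L (x t) = 0
    linarith
  set W : ℝ → ℝ := fun t => disagreement A (x t)
  have hWc : Continuous W := (contDiff_disagreement A).continuous.comp hxc
  set W' : ℝ → ℝ := fun t => -∑ p, relativeMap k A (x t) p * g (x t) p
  have hW : ∀ t, 0 < t → HasDerivAt W (W' t) t := fun t ht => by
    have := (((contDiff_disagreement A).differentiable (by simp)) (x t)).hasFDerivAt.comp_hasDerivAt
      t (hx t ht)
    have he : W' t = fderiv ℝ (disagreement A) (x t) (g (x t)) :=
      (hA.fderiv_disagreement _ _).symm
    rw [he]
    exact this
  have hWneg : ∀ t, 0 < t → W' t ≤ 0 := by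
    intro t ht
    refine neg_nonpos.2 (Finset.sum_nonneg fun p _ => ?_)
    by_cases hp : p.1 ∈ Ic
    · rw [hg1 _ p hp]
      set u := relativeMap k A (x t) p
      by_cases hu : u = 0
      · simp [hu]
      -- Clamping multiplies by a positive factor, so the control keeps its sign and the energy
      -- decreases even before the clamp is known to be inactive.
      · set c := η / max η |u|
        have hc : 0 < c := div_pos hη (lt_max_of_lt_left hη)
        have h1 : 0 < ψ p (c * u) * (c * u) := hh.mul_self_pos p hp _ (mul_ne_zero hc.ne' hu)
        have h2 : 0 < c * (u * ψ p (c * u)) := by linarith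
        exact (pos_of_mul_pos_right h2 hc.le).le
    · rw [hslide t ht.le p hp, zero_mul]
  -- The initial energy was scaled so that its decrease keeps the clamp inactive forever; the curve
  -- thus follows the true controls.
  have hsmall : ∀ t, 0 ≤ t → ∀ p, |relativeMap k A (x t) p| ≤ η := by
    intro t ht p
    refine (abs_apply_le_norm _ p).trans (abs_le_of_sq_le_sq' ?_ hη.le).2
    refine (hC _).trans (le_trans ?_ hsη)
    have h1 : W t ≤ W 0 := le_of_hasDerivAt_nonpos_of_pos hWc hW hWneg ht
    have h2 : W 0 = disagreement A (s • z) := by simp only [W, hx0]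
    have h3 : -⟪relativeMap k A (x t), x t⟫ = 2 * W t := by
      simp only [W, disagreement]; ring
    rw [h3, ← h2]
    nlinarith
  have hgψ : ∀ t, 0 ≤ t → ∀ p, p.1 ∈ Ic → g (x t) p = ψ p (relativeMap k A (x t) p) :=
    fun t ht p hp => by rw [hg1 _ p hp, radialClamp_of_abs_le hη (hsmall t ht p)]
  have hmax : IsMaximalFilippovSolution h ⊤ x := by
    refine IsMaximalFilippovSolution.of_hasDerivAt hxL fun t ht => ⟨g (x t), ?_, hx t ht⟩
    refine hh.mem_filippovMap_of_sliding hA ⟨i, hi⟩ (hslide t ht.le) (hgψ t ht.le) fun p _ => ?_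
    exact (abs_apply_le_norm _ p).trans (by simpa using hgM (x t))
  have hWlow : ∀ t, 0 < t → -(2 * K * C) * W t ≤ W' t := by
    intro t ht
    have h1 : ∑ p, relativeMap k A (x t) p * g (x t) p ≤ K * ‖relativeMap k A (x t)‖ ^ 2 := by
      rw [norm_sq_agentState, Finset.mul_sum]
      refine Finset.sum_le_sum fun p _ => ?_
      by_cases hp : p.1 ∈ Ic
      · rw [hgψ t ht.le p hp]
        have h2 := hK p hp _ ((hsmall t ht.le p).trans (min_le_left _ _))
        calc _ ≤ |relativeMap k A (x t) p * ψ p (relativeMap k A (x t) p)| := le_abs_self _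
          _ = |relativeMap k A (x t) p| * |ψ p (relativeMap k A (x t) p)| := abs_mul _ _
          _ ≤ |relativeMap k A (x t) p| * (K * |relativeMap k A (x t) p|) := by gcongr
          _ = K * |relativeMap k A (x t) p| ^ 2 := by ring
          _ = _ := by rw [sq_abs]
      · rw [hslide t ht.le p hp]; simp
    have h2 : ‖relativeMap k A (x t)‖ ^ 2 ≤ C * (2 * W t) := by
      refine (hC _).trans (le_of_eq ?_)
      simp only [W, disagreement]; ring
    have h3 : K * ‖relativeMap k A (x t)‖ ^ 2 ≤ K * (C * (2 * W t)) := by gcongr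
    simp only [W']
    linarith
  obtain ⟨-, t₀, ht₀, c, hc⟩ := hcons ⊤ x hmax
  have hWt₀ : W t₀ = 0 := by
    simp only [W]
    rw [hc t₀ le_rfl, IsConnectedWeights.disagreement_consensusState]
  have hW0 : 0 < W 0 := by
    simp only [W]
    rw [hx0, hVs]
    positivity
  -- W(t) exp(2KCt) is nondecreasing, so W cannot pass from a positive value to zero.
  have hexp := le_of_hasDerivAt_nonpos_of_pos
    (g := fun t => -(W t * Real.exp (2 * K * C * t)))
    (g' := fun t => -(W' t * Real.exp (2 * K * C * t) +
      W t * (Real.exp (2 * K * C * t) * (2 * K * C * 1))))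
    (by fun_prop)
    (fun t ht => ((hW t ht).mul ((hasDerivAt_id t).const_mul (2 * K * C)).exp).neg)
    (fun t ht => by
      have h1 := mul_le_mul_of_nonneg_right (hWlow t ht) (Real.exp_pos (2 * K * C * t)).le
      linarith) ht₀.le
  simp only [hWt₀, zero_mul, neg_zero, mul_zero, Real.exp_zero, mul_one] at hexp
  linarith

end IsScalarFeedback

end

theorem mainTheorem4 {n k : ℕ} (hk : 0 < k)
    (G : SimpleGraph (Fin n)) (hG : G.Connected)
    (w : Fin n → Fin n → ℝ) (hw_symm : ∀ i j, G.Adj i j → w i j = w j i)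
    (hw_pos : ∀ i j, G.Adj i j → 0 < w i j)
    (Ic : Finset (Fin n)) (f : Fin n → (Fin k → ℝ) → (Fin k → ℝ))
    (hf : ComponentwiseControl Ic f) :
    (2 < n → (FiniteTimeConsensus (closedLoop (weightedAdj G w) f) ↔ Ic.card = 1)) ∧
    (n = 2 → (FiniteTimeConsensus (closedLoop (weightedAdj G w) f) ↔ Ic.card ≤ 1)) := by
  have hA := isConnectedWeights_weightedAdj hG hw_symm hw_pos
  obtain ⟨ψ, hh⟩ := hf.exists_isScalarFeedback (weightedAdj G w)
  refine ⟨fun hn => ⟨fun hc => ?_, hh.finiteTimeConsensus_of_card_eq_one hA hn.le⟩, ?_⟩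
  · rcases Nat.lt_trichotomy Ic.card 1 with h | h | h
    · exact absurd hc (hh.not_finiteTimeConsensus_of_card_eq_zero hA
        (Finset.card_eq_zero.1 (Nat.lt_one_iff.1 h)) hn hk)
    · exact h
    · exact absurd hc (hh.not_finiteTimeConsensus_of_one_lt_card hA h hk)
  · rintro rfl
    refine ⟨fun hc => ?_, fun h => ?_⟩
    · by_contra! h
      exact hh.not_finiteTimeConsensus_of_one_lt_card hA h hk hc
    · rcases Nat.le_one_iff_eq_zero_or_eq_one.1 h with h | h
      · exact hh.finiteTimeConsensus_of_two_of_card_eq_zero hA (Finset.card_eq_zero.1 h)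
      · exact hh.finiteTimeConsensus_of_card_eq_one hA le_rfl h
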